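/- Let $\mathrm{For}_{\mathsf{BCL}}$ be the set of formulas built from variables $p_0,p_1,p_2,\dots$ with $\neg,\wedge,\vee,\to$, and let $\mathrm{For}_{\mathsf{MBCL}}$ be the set of formulas built in the same way with the additional unary connectives $\Box,\Diamond$. Write $A\supset B:=\neg A\vee B$, $A\equiv B:=(\neg A\vee B)\wedge(\neg B\vee A)$, and $\neg^kA$ for $A$ preceded by $k$ negation signs. $Ax_{\mathsf{BCL}}$ is the Hilbert calculus over $\mathrm{For}_{\mathsf{BCL}}$ with the rule "from $A$ and $A\supset B$ infer $B$" and the axioms: all substitution instances of classical propositional tautologies in $\neg,\wedge,\vee$; and, for all formulas $A,B$, $$\neg(A\to\neg A),\qquad \neg(\neg A\to A),\qquad (A\to B)\to\neg(A\to\neg B),$$ $$(A\to\neg B)\to\neg(A\to B),\qquad (A\to B)\supset(A\supset B).$$ $Ax_{\mathsf{MBCL}}$ is the calculus over $\mathrm{For}_{\mathsf{MBCL}}$ with the same axiom schemata and rule (now for all formulas of $\mathrm{For}_{\mathsf{MBCL}}$), the axioms $\Diamond A\equiv\neg\Box\neg A$ and $\Box(A\supset B)\supset(\Box A\supset\Box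 B)$, and the necessitation rule "from $\vdash A$ infer $\vdash\Box A$". For natural numbers $k,l,m,n$ with $k\le m$, $l\le n$ and $k,l$ even, $Ax_{\mathsf{BCL}}^{\mathsf{GCUN}}$ and $Ax_{\mathsf{MBCL}}^{\mathsf{GCUN}}$ are obtained from $Ax_{\mathsf{BCL}}$ and $Ax_{\mathsf{MBCL}}$, respectively, by adding the axiom schemata $$(A\to B)\supset\big((\neg A\to\neg B)\vee(\neg A\wedge B)\big),\qquad (A\to B)\supset(\neg\neg A\to\neg\neg B),$$ $$(\neg^kA\to\neg^lB)\supset\big((\neg^mA\to\neg^nB)\vee(\neg^mA\wedge\neg^{n+1}B)\big),$$ $$(\neg^kA\to\neg^lB)\supset(\neg^{2m-k}A\to\neg^{2n-l}B).$$ Then the logics $Ax_{\mathsf{BCL}}$ and $Ax_{\mathsf{MBCL}}$ are decidable, and, for every such quadruple $k,l,m,n$, the logics $Ax_{\mathsf{BCL}}^{\mathsf{GCUN}}$ and $Ax_{\mathsf{MBCL}}^{\mathsf{GCUN}}$ are decidable: in each case the set of formulas that are theorems of the calculus is a decidable (recursive) set. -/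

import Mathlib

namespace Connexive

/-- Formulas of classical propositional logic over negation, conjunction and disjunction. -/
inductive PL : Type
  | var (i : ℕ)
  | neg (P : PL)
  | and (P Q : PL)
  | or (P Q : PL)

namespace PL

/-- Classical truth value under the valuation `v`. -/
def eval (v : ℕ → Bool) : PL → Bool
  | var i => v i
  | neg P => !(eval v P)
  | and P Q => eval v P && eval v Q
  | or P Q => eval v P || eval v Q

/-- Classical propositional tautologies. -/
def IsTautology (P : PL) : Prop := ∀ v : ℕ → Bool, P.eval v = true

end PL

/-- Formulas of the language of BCL: `¬`, `∧`, `∨` and the relating implication `→`. -/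
inductive BForm : Type
  | var (i : ℕ)
  | neg (A : BForm)
  | and (A B : BForm)
  | or (A B : BForm)
  | imp (A B : BForm)

namespace BForm

/-- Material implication `A ⊃ B := ¬A ∨ B`. -/
def mimp (A B : BForm) : BForm := or (neg A) B

/-- Material equivalence `A ≡ B := (¬A ∨ B) ∧ (¬B ∨ A)`. -/
def miff (A B : BForm) : BForm := and (or (neg A) B) (or (neg B) A)

/-- `negs k A` is `¬ᵏ A`, the formula `A` preceded by `k` negation signs. -/
def negs : ℕ → BForm → BForm
  | 0, A => A
  | k + 1, A => neg (negs k A)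

/-- Uniform substitution of formulas for the variables of a classical formula. -/
def inst (s : ℕ → BForm) : PL → BForm
  | .var i => s i
  | .neg P => neg (inst s P)
  | .and P Q => and (inst s P) (inst s Q)
  | .or P Q => or (inst s P) (inst s Q)

/-- Gödel numbering (a bijection with the natural numbers). -/
def code : BForm → ℕ
  | var i => 5 * i
  | neg A => 5 * code A + 1
  | and A B => 5 * Nat.pair (code A) (code B) + 2
  | or A B => 5 * Nat.pair (code A) (code B) + 3
  | imp A B => 5 * Nat.pair (code A) (code B) + 4

theorem lt_of_mod_eq {x r : ℕ} (h : x % 5 = r + 1) : x / 5 < x := by omega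

theorem left_lt {x r : ℕ} (h : x % 5 = r + 1) : (Nat.unpair (x / 5)).1 < x :=
  lt_of_le_of_lt (Nat.unpair_left_le _) (lt_of_mod_eq h)

theorem right_lt {x r : ℕ} (h : x % 5 = r + 1) : (Nat.unpair (x / 5)).2 < x :=
  lt_of_le_of_lt (Nat.unpair_right_le _) (lt_of_mod_eq h)

/-- The formula with a given Gödel number. -/
def ofCode (x : ℕ) : BForm :=
  match h : x % 5 with
  | 0 => var (x / 5)
  | 1 => neg (ofCode (x / 5))
  | 2 => and (ofCode (Nat.unpair (x / 5)).1) (ofCode (Nat.unpair (x / 5)).2)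
  | 3 => or (ofCode (Nat.unpair (x / 5)).1) (ofCode (Nat.unpair (x / 5)).2)
  | _ + 4 => imp (ofCode (Nat.unpair (x / 5)).1) (ofCode (Nat.unpair (x / 5)).2)
termination_by x
decreasing_by all_goals first | exact lt_of_mod_eq h | exact left_lt h | exact right_lt h

theorem ofCode_code (A : BForm) : ofCode (code A) = A := by
  induction A with
  | var i =>
    have h1 : code (var i) % 5 = 0 := by simp only [code]; omega
    have h2 : code (var i) / 5 = i := by simp only [code]; omega
    rw [ofCode]
    split <;> simp_all
  | neg A ih =>
    have h1 : code (neg A) % 5 = 1 := by simp only [code]; omega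
    have h2 : code (neg A) / 5 = code A := by simp only [code]; omega
    rw [ofCode]
    split <;> simp_all
  | and A B ihA ihB =>
    have h1 : code (and A B) % 5 = 2 := by simp only [code]; omega
    have h2 : code (and A B) / 5 = Nat.pair (code A) (code B) := by simp only [code]; omega
    rw [ofCode]
    split <;> simp_all
  | or A B ihA ihB =>
    have h1 : code (or A B) % 5 = 3 := by simp only [code]; omega
    have h2 : code (or A B) / 5 = Nat.pair (code A) (code B) := by simp only [code]; omega
    rw [ofCode]
    split <;> simp_all
  | imp A B ihA ihB =>
    have h1 : code (imp A B) % 5 = 4 := by simp only [code]; omega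
    have h2 : code (imp A B) / 5 = Nat.pair (code A) (code B) := by simp only [code]; omega
    rw [ofCode]
    split <;> simp_all

theorem code_ofCode (x : ℕ) : code (ofCode x) = x := by
  induction x using Nat.strong_induction_on with
  | _ x ih =>
    have hx : 5 * (x / 5) + x % 5 = x := Nat.div_add_mod x 5
    have hlt : x % 5 < 5 := Nat.mod_lt _ (by norm_num)
    rw [ofCode]
    split
    all_goals rename_i h
    all_goals simp only [code]
    · omega
    all_goals have a1 := ih _ (lt_of_mod_eq h)
    all_goals have a2 := ih _ (left_lt h)
    all_goals have a3 := ih _ (right_lt h)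
    all_goals simp only [a1, a2, a3, Nat.pair_unpair]
    all_goals omega

/-- The Gödel numbering as a bijection. -/
def codeEquiv : BForm ≃ ℕ where
  toFun := code
  invFun := ofCode
  left_inv := ofCode_code
  right_inv := code_ofCode

/-- Computability on formulas is computability on Gödel numbers. -/
instance : Primcodable BForm := Primcodable.ofEquiv ℕ codeEquiv

end BForm

/-- Formulas of the language of MBCL: the language of BCL with `□` and `◇`. -/
inductive MForm : Type
  | var (i : ℕ)
  | neg (A : MForm)
  | and (A B : MForm)
  | or (A B : MForm)
  | imp (A B : MForm)
  | box (A : MForm)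
  | dia (A : MForm)

namespace MForm

/-- Material implication `A ⊃ B := ¬A ∨ B`. -/
def mimp (A B : MForm) : MForm := or (neg A) B

/-- Material equivalence `A ≡ B := (¬A ∨ B) ∧ (¬B ∨ A)`. -/
def miff (A B : MForm) : MForm := and (or (neg A) B) (or (neg B) A)

/-- `negs k A` is `¬ᵏ A`, the formula `A` preceded by `k` negation signs. -/
def negs : ℕ → MForm → MForm
  | 0, A => A
  | k + 1, A => neg (negs k A)

/-- Uniform substitution of formulas for the variables of a classical formula. -/
def inst (s : ℕ → MForm) : PL → MForm
  | .var i => s i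
  | .neg P => neg (inst s P)
  | .and P Q => and (inst s P) (inst s Q)
  | .or P Q => or (inst s P) (inst s Q)

/-- Gödel numbering (a bijection with the natural numbers). -/
def code : MForm → ℕ
  | var i => 7 * i
  | neg A => 7 * code A + 1
  | and A B => 7 * Nat.pair (code A) (code B) + 2
  | or A B => 7 * Nat.pair (code A) (code B) + 3
  | imp A B => 7 * Nat.pair (code A) (code B) + 4
  | box A => 7 * code A + 5
  | dia A => 7 * code A + 6

theorem lt_of_mod_eq {x r : ℕ} (h : x % 7 = r + 1) : x / 7 < x := by omega

theorem left_lt {x r : ℕ} (h : x % 7 = r + 1) : (Nat.unpair (x / 7)).1 < x :=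
  lt_of_le_of_lt (Nat.unpair_left_le _) (lt_of_mod_eq h)

theorem right_lt {x r : ℕ} (h : x % 7 = r + 1) : (Nat.unpair (x / 7)).2 < x :=
  lt_of_le_of_lt (Nat.unpair_right_le _) (lt_of_mod_eq h)

/-- The formula with a given Gödel number. -/
def ofCode (x : ℕ) : MForm :=
  match h : x % 7 with
  | 0 => var (x / 7)
  | 1 => neg (ofCode (x / 7))
  | 2 => and (ofCode (Nat.unpair (x / 7)).1) (ofCode (Nat.unpair (x / 7)).2)
  | 3 => or (ofCode (Nat.unpair (x / 7)).1) (ofCode (Nat.unpair (x / 7)).2)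
  | 4 => imp (ofCode (Nat.unpair (x / 7)).1) (ofCode (Nat.unpair (x / 7)).2)
  | 5 => box (ofCode (x / 7))
  | _ + 6 => dia (ofCode (x / 7))
termination_by x
decreasing_by all_goals first | exact lt_of_mod_eq h | exact left_lt h | exact right_lt h

theorem ofCode_code (A : MForm) : ofCode (code A) = A := by
  induction A with
  | var i =>
    have h1 : code (var i) % 7 = 0 := by simp only [code]; omega
    have h2 : code (var i) / 7 = i := by simp only [code]; omega
    rw [ofCode]
    split <;> simp_all
  | neg A ih =>
    have h1 : code (neg A) % 7 = 1 := by simp only [code]; omega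
    have h2 : code (neg A) / 7 = code A := by simp only [code]; omega
    rw [ofCode]
    split <;> simp_all
  | and A B ihA ihB =>
    have h1 : code (and A B) % 7 = 2 := by simp only [code]; omega
    have h2 : code (and A B) / 7 = Nat.pair (code A) (code B) := by simp only [code]; omega
    rw [ofCode]
    split <;> simp_all
  | or A B ihA ihB =>
    have h1 : code (or A B) % 7 = 3 := by simp only [code]; omega
    have h2 : code (or A B) / 7 = Nat.pair (code A) (code B) := by simp only [code]; omega
    rw [ofCode]
    split <;> simp_all
  | imp A B ihA ihB =>
    have h1 : code (imp A B) % 7 = 4 := by simp only [code]; omega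
    have h2 : code (imp A B) / 7 = Nat.pair (code A) (code B) := by simp only [code]; omega
    rw [ofCode]
    split <;> simp_all
  | box A ih =>
    have h1 : code (box A) % 7 = 5 := by simp only [code]; omega
    have h2 : code (box A) / 7 = code A := by simp only [code]; omega
    rw [ofCode]
    split <;> simp_all
  | dia A ih =>
    have h1 : code (dia A) % 7 = 6 := by simp only [code]; omega
    have h2 : code (dia A) / 7 = code A := by simp only [code]; omega
    rw [ofCode]
    split <;> simp_all

theorem code_ofCode (x : ℕ) : code (ofCode x) = x := by
  induction x using Nat.strong_induction_on with
  | _ x ih =>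
    have hx : 7 * (x / 7) + x % 7 = x := Nat.div_add_mod x 7
    have hlt : x % 7 < 7 := Nat.mod_lt _ (by norm_num)
    rw [ofCode]
    split
    all_goals rename_i h
    all_goals simp only [code]
    · omega
    all_goals have a1 := ih _ (lt_of_mod_eq h)
    all_goals have a2 := ih _ (left_lt h)
    all_goals have a3 := ih _ (right_lt h)
    all_goals simp only [a1, a2, a3, Nat.pair_unpair]
    all_goals omega

/-- The Gödel numbering as a bijection. -/
def codeEquiv : MForm ≃ ℕ where
  toFun := code
  invFun := ofCode
  left_inv := ofCode_code
  right_inv := code_ofCode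

/-- Computability on formulas is computability on Gödel numbers. -/
instance : Primcodable MForm := Primcodable.ofEquiv ℕ codeEquiv

end MForm

section
open BForm

/-- Axioms of the system `Ax_BCL`. -/
inductive AxBCL : BForm → Prop
  | cpl (P : PL) (s : ℕ → BForm) : P.IsTautology → AxBCL (inst s P)
  | a1 (A : BForm) : AxBCL (neg (imp A (neg A)))
  | a2 (A : BForm) : AxBCL (neg (imp (neg A) A))
  | b1 (A B : BForm) : AxBCL (imp (imp A B) (neg (imp A (neg B))))
  | b2 (A B : BForm) : AxBCL (imp (imp A (neg B)) (neg (imp A B)))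
  | impl (A B : BForm) : AxBCL (mimp (imp A B) (mimp A B))

/-- Axioms of the system `Ax_BCL^GCUN` for the quadruple `k, l, m, n`. -/
inductive AxBCLGCUN (k l m n : ℕ) : BForm → Prop
  | base {A : BForm} : AxBCL A → AxBCLGCUN k l m n A
  | cun1 (A B : BForm) : AxBCLGCUN k l m n
      (mimp (imp A B) (or (imp (neg A) (neg B)) (and (neg A) B)))
  | cun2 (A B : BForm) : AxBCLGCUN k l m n
      (mimp (imp A B) (imp (neg (neg A)) (neg (neg B))))
  | gcun1 (A B : BForm) : AxBCLGCUN k l m n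
      (mimp (imp (negs k A) (negs l B))
        (or (imp (negs m A) (negs n B)) (and (negs m A) (negs (n + 1) B))))
  | gcun2 (A B : BForm) : AxBCLGCUN k l m n
      (mimp (imp (negs k A) (negs l B)) (imp (negs (2 * m - k) A) (negs (2 * n - l) B)))

/-- Theorems of the Hilbert calculus with axioms `Ax` and the disjunctive syllogism rule (from `A` and `A ⊃ B` infer `B`). -/
inductive BCLTheorem (Ax : BForm → Prop) : BForm → Prop
  | ax {A : BForm} : Ax A → BCLTheorem Ax A
  | ds {A B : BForm} : BCLTheorem Ax A → BCLTheorem Ax (mimp A B) → BCLTheorem Ax B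

end

section
open MForm

/-- Axioms of the system `Ax_MBCL`. -/
inductive AxMBCL : MForm → Prop
  | cpl (P : PL) (s : ℕ → MForm) : P.IsTautology → AxMBCL (inst s P)
  | a1 (A : MForm) : AxMBCL (neg (imp A (neg A)))
  | a2 (A : MForm) : AxMBCL (neg (imp (neg A) A))
  | b1 (A B : MForm) : AxMBCL (imp (imp A B) (neg (imp A (neg B))))
  | b2 (A B : MForm) : AxMBCL (imp (imp A (neg B)) (neg (imp A B)))
  | impl (A B : MForm) : AxMBCL (mimp (imp A B) (mimp A B))
  | dual (A : MForm) : AxMBCL (miff (dia A) (neg (box (neg A))))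
  | kk (A B : MForm) : AxMBCL (mimp (box (mimp A B)) (mimp (box A) (box B)))

/-- Axioms of the system `Ax_MBCL^GCUN` for the quadruple `k, l, m, n`. -/
inductive AxMBCLGCUN (k l m n : ℕ) : MForm → Prop
  | base {A : MForm} : AxMBCL A → AxMBCLGCUN k l m n A
  | cun1 (A B : MForm) : AxMBCLGCUN k l m n
      (mimp (imp A B) (or (imp (neg A) (neg B)) (and (neg A) B)))
  | cun2 (A B : MForm) : AxMBCLGCUN k l m n
      (mimp (imp A B) (imp (neg (neg A)) (neg (neg B))))
  | gcun1 (A B : MForm) : AxMBCLGCUN k l m n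
      (mimp (imp (negs k A) (negs l B))
        (or (imp (negs m A) (negs n B)) (and (negs m A) (negs (n + 1) B))))
  | gcun2 (A B : MForm) : AxMBCLGCUN k l m n
      (mimp (imp (negs k A) (negs l B)) (imp (negs (2 * m - k) A) (negs (2 * n - l) B)))

/-- Theorems of the Hilbert calculus with axioms `Ax` and disjunctive syllogism (from `A` and `A ⊃ B` infer `B`) and
necessitation (from `⊢ A` infer `⊢ □A`). -/
inductive MBCLTheorem (Ax : MForm → Prop) : MForm → Prop
  | ax {A : MForm} : Ax A → MBCLTheorem Ax A
  | ds {A B : MForm} : MBCLTheorem Ax A → MBCLTheorem Ax (mimp A B) → MBCLTheorem Ax B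
  | nec {A : MForm} : MBCLTheorem Ax A → MBCLTheorem Ax (box A)

end

end Connexive

/-! Each modal calculus has the finite model property with a computable bound. For a set `T` of
formulas that respects the classical connectives, the axioms on `→` say that Boethius' implications
belong to `T`, that Aristotle's implications do not, that `C → D` yields `C ⊃ D`, and (for GCUN)
that `T` is closed under moves from `C → D` to some `C' → D'` with more negations, each admissible
when `C' ⊃ D'` is true. `Sys` abstracts this situation.

Since the truth of `C → D` is not determined by the truth values of its parts, a valuation of the
formulas with Gödel number below `N` extends to a model: let the true implications be those reached
by admissible moves from seeds, which are the implications already true and Boethius' instances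
whose material counterpart is true. Moves never lower Gödel numbers, so nothing new becomes true
below `N` (`val_eq`). The axioms of Boethius and Aristotle survive provided that no two seeds lead
to `A → B` and `A → ¬B`, and no seed leads to `A → ¬A` or `¬A → A`. The predicates `conf` and `diag`
detect these dangers from the seeds alone. They must catch every dangerous path, yet never exclude
what a maximal consistent set contains.

Hence a formula is a theorem iff it is true throughout every coherent finite family of such
valuations (`thm_iff`). One direction builds a Kripke model on the family (`val_thm`), the other
truncates all maximal consistent sets (`canon_coh`). The search over families is primitive
recursive. If two of Boethius' instances already conflict, the calculus is inconsistent and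
decidable for that reason.

For GCUN put `d = m - k` and `e = n - l`. On the implications `¬ⁱA → ¬ʲB` the moves shift `(i, j)`
by `(1, 1)`, `(2, 2)`, `(d, e)` and `(2d, 2e)`. The parity analysis in `Grid.no_conf` and
`gcun_ok_path` shows that explicit arithmetical conditions meet both demands.

The calculi without modalities reduce to the modal ones, which are conservative over them: erasing
`□` and `◇` turns modal proofs into proofs of the smaller calculus. -/

namespace Connexive
namespace MForm

/-! ### Derivability from hypotheses and maximal consistent sets -/

/-- A set of formulas that respects the classical connectives. -/
structure Cl (T : MForm → Prop) : Prop where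
  neg : ∀ A, T (neg A) ↔ ¬ T A
  and : ∀ A B, T (and A B) ↔ T A ∧ T B
  or : ∀ A B, T (or A B) ↔ T A ∨ T B

theorem Cl.mimp {T : MForm → Prop} (h : Cl T) (A B : MForm) : T (mimp A B) ↔ (T A → T B) := by
  rw [MForm.mimp, h.or, h.neg]; tauto

theorem Cl.miff {T : MForm → Prop} (h : Cl T) (A B : MForm) : T (miff A B) ↔ (T A ↔ T B) := by
  rw [MForm.miff, h.and, h.or, h.or, h.neg, h.neg]; tauto

theorem Cl.inst {T : MForm → Prop} (h : Cl T) {P : PL} (hP : P.IsTautology) (s : ℕ → MForm) :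
    T (inst s P) := by
  classical
  have key : ∀ Q : PL, T (MForm.inst s Q) ↔ Q.eval (fun i => decide (T (s i))) = true := by
    intro Q
    induction Q with
    | var i => simp [MForm.inst, PL.eval]
    | neg P ih => simp [MForm.inst, PL.eval, h.neg, ih]
    | and P Q ih1 ih2 => simp [MForm.inst, PL.eval, h.and, ih1, ih2]
    | or P Q ih1 ih2 => simp [MForm.inst, PL.eval, h.or, ih1, ih2]
  exact (key P).2 (hP _)

/-- Derivability from the theorems of `Ax` and the hypotheses `G` by disjunctive syllogism. -/
inductive Der (Ax : MForm → Prop) (G : Set MForm) : MForm → Prop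
  | thm {A} : MBCLTheorem Ax A → Der Ax G A
  | hyp {A} : A ∈ G → Der Ax G A
  | ds {A B} : Der Ax G A → Der Ax G (mimp A B) → Der Ax G B

variable {Ax : MForm → Prop} {G : Set MForm}

theorem Der.mono {H : Set MForm} (h : G ⊆ H) {A : MForm} (d : Der Ax G A) : Der Ax H A := by
  induction d with
  | thm t => exact .thm t
  | hyp t => exact .hyp (h t)
  | ds _ _ i1 i2 => exact .ds i1 i2

theorem Der.toThm {A : MForm} (d : Der Ax ∅ A) : MBCLTheorem Ax A := by
  induction d with
  | thm t => exact t
  | hyp t => exact absurd t (Set.notMem_empty _)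
  | ds _ _ i1 i2 => exact .ds i1 i2

section
variable (hAx : ∀ A, AxMBCL A → Ax A)
include hAx

theorem thm_taut {P : PL} (hP : P.IsTautology) (s : ℕ → MForm) : MBCLTheorem Ax (inst s P) :=
  .ax (hAx _ (.cpl P s hP))

theorem thm_weaken (A B : MForm) : MBCLTheorem Ax (mimp B (mimp A B)) :=
  thm_taut hAx (P := .or (.neg (.var 1)) (.or (.neg (.var 0)) (.var 1)))
    (by intro v; simp only [PL.eval]; cases v 0 <;> cases v 1 <;> rfl)
    (fun i => if i = 0 then A else B)

theorem thm_self (A : MForm) : MBCLTheorem Ax (mimp A A) :=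
  thm_taut hAx (P := .or (.neg (.var 0)) (.var 0))
    (by intro v; simp only [PL.eval]; cases v 0 <;> rfl) (fun _ => A)

theorem thm_distrib (A B C : MForm) :
    MBCLTheorem Ax (mimp (mimp A B) (mimp (mimp A (mimp B C)) (mimp A C))) :=
  thm_taut hAx (P := .or (.neg (.or (.neg (.var 0)) (.var 1)))
      (.or (.neg (.or (.neg (.var 0)) (.or (.neg (.var 1)) (.var 2))))
        (.or (.neg (.var 0)) (.var 2))))
    (by intro v; simp only [PL.eval]; cases v 0 <;> cases v 1 <;> cases v 2 <;> rfl)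
    (fun i => if i = 0 then A else if i = 1 then B else C)

/-- Necessitation is available only inside `Der.thm`, never on hypotheses, so disjunctive syllogism
is the only rule to lift. -/
theorem Der.deduction {X A : MForm} (d : Der Ax (insert X G) A) : Der Ax G (mimp X A) := by
  induction d with
  | thm t => exact .ds (.thm t) (.thm (thm_weaken hAx _ _))
  | hyp t =>
    rcases t with rfl | t
    · exact .thm (thm_self hAx _)
    · exact .ds (.hyp t) (.thm (thm_weaken hAx _ _))
  | ds _ _ i1 i2 => exact .ds i2 (.ds i1 (.thm (thm_distrib hAx _ _ _)))

theorem Der.box {A : MForm} (d : Der Ax {Y | MForm.box Y ∈ G} A) : Der Ax G (box A) := by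
  induction d with
  | thm t => exact .thm (.nec t)
  | hyp t => exact .hyp t
  | ds _ _ i1 i2 => exact .ds i1 (.ds i2 (.thm (.ax (hAx _ (.kk _ _)))))

end

/-- A contradiction. -/
def bot : MForm := and (var 0) (neg (var 0))

/-- Consistency: no contradiction is derivable. -/
def Con (Ax : MForm → Prop) (G : Set MForm) : Prop := ¬ Der Ax G bot

/-- Maximal consistency. -/
structure MCS (Ax : MForm → Prop) (G : Set MForm) : Prop where
  con : Con Ax G
  max : ∀ X, Con Ax (insert X G) → X ∈ G

/-- A derivation uses finitely many hypotheses; where two subderivations meet, the larger of the two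
chain members serves both. -/
theorem Der.sUnion {c : Set (Set MForm)} (hc : IsChain (· ⊆ ·) c) (hne : c.Nonempty) {A : MForm}
    (d : Der Ax (⋃₀ c) A) : ∃ H ∈ c, Der Ax H A := by
  induction d with
  | thm t => exact hne.imp fun H h => ⟨h, .thm t⟩
  | hyp t => obtain ⟨H, h1, h2⟩ := t; exact ⟨H, h1, .hyp h2⟩
  | ds _ _ i1 i2 =>
    obtain ⟨H1, h1, d1⟩ := i1
    obtain ⟨H2, h2, d2⟩ := i2
    rcases hc.total h1 h2 with h | h
    · exact ⟨H2, h2, .ds (d1.mono h) d2⟩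
    · exact ⟨H1, h1, .ds d1 (d2.mono h)⟩

theorem exists_mcs (h : Con Ax G) : ∃ H, G ⊆ H ∧ MCS Ax H := by
  obtain ⟨M, hGM, hM⟩ := zorn_subset_nonempty {H | Con Ax H} (fun c hcS hc hne => by
    refine ⟨⋃₀ c, fun d => ?_, fun s hs => Set.subset_sUnion_of_mem hs⟩
    obtain ⟨H, h1, h2⟩ := d.sUnion hc hne
    exact hcS h1 h2) G h
  refine ⟨M, hGM, hM.prop, fun X hX => ?_⟩
  exact hM.le_of_ge hX (Set.subset_insert X M) (Set.mem_insert X M)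

section
variable (hAx : ∀ A, AxMBCL A → Ax A)
include hAx

theorem thm_explode (A : MForm) : MBCLTheorem Ax (mimp A (mimp (neg A) bot)) :=
  thm_taut hAx (P := .or (.neg (.var 1)) (.or (.neg (.neg (.var 1)))
      (.and (.var 0) (.neg (.var 0)))))
    (by intro v; simp only [PL.eval]; cases v 0 <;> cases v 1 <;> rfl)
    (fun i => if i = 0 then var 0 else A)

theorem thm_reductio (A : MForm) : MBCLTheorem Ax (mimp (mimp (neg A) bot) A) :=
  thm_taut hAx (P := .or (.neg (.or (.neg (.neg (.var 1))) (.and (.var 0) (.neg (.var 0)))))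
      (.var 1))
    (by intro v; simp only [PL.eval]; cases v 0 <;> cases v 1 <;> rfl)
    (fun i => if i = 0 then var 0 else A)

theorem thm_neg_intro (A : MForm) : MBCLTheorem Ax (mimp (mimp A bot) (neg A)) :=
  thm_taut hAx (P := .or (.neg (.or (.neg (.var 1)) (.and (.var 0) (.neg (.var 0)))))
      (.neg (.var 1)))
    (by intro v; simp only [PL.eval]; cases v 0 <;> cases v 1 <;> rfl)
    (fun i => if i = 0 then var 0 else A)

theorem con_insert_neg {A : MForm} (h : ¬ Der Ax G A) : Con Ax (insert (neg A) G) :=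
  fun d => h (.ds (d.deduction hAx) (.thm (thm_reductio hAx A)))

theorem MCS.mem_of_der (hG : MCS Ax G) {A : MForm} (d : Der Ax G A) : A ∈ G :=
  hG.max A fun d' => hG.con (.ds d (d'.deduction hAx))

theorem MCS.neg_mem (hG : MCS Ax G) (A : MForm) : neg A ∈ G ↔ A ∉ G := by
  constructor
  · exact fun h1 h2 => hG.con (.ds (.hyp h1) (.ds (.hyp h2) (.thm (thm_explode hAx A))))
  · intro h
    by_contra h'
    refine h (hG.max A fun d => h' (hG.mem_of_der hAx ?_))
    exact .ds (d.deduction hAx) (.thm (thm_neg_intro hAx A))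

theorem MCS.cl (hG : MCS Ax G) : Cl (· ∈ G) where
  neg := hG.neg_mem hAx
  and A B := by
    have t1 : MBCLTheorem Ax (mimp (.and A B) A) :=
      thm_taut hAx (P := .or (.neg (.and (.var 0) (.var 1))) (.var 0))
        (by intro v; simp only [PL.eval]; cases v 0 <;> cases v 1 <;> rfl)
        (fun i => if i = 0 then A else B)
    have t2 : MBCLTheorem Ax (mimp (.and A B) B) :=
      thm_taut hAx (P := .or (.neg (.and (.var 0) (.var 1))) (.var 1))
        (by intro v; simp only [PL.eval]; cases v 0 <;> cases v 1 <;> rfl)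
        (fun i => if i = 0 then A else B)
    have t3 : MBCLTheorem Ax (mimp A (mimp B (.and A B))) :=
      thm_taut hAx (P := .or (.neg (.var 0)) (.or (.neg (.var 1)) (.and (.var 0) (.var 1))))
        (by intro v; simp only [PL.eval]; cases v 0 <;> cases v 1 <;> rfl)
        (fun i => if i = 0 then A else B)
    exact ⟨fun h => ⟨hG.mem_of_der hAx (.ds (.hyp h) (.thm t1)),
      hG.mem_of_der hAx (.ds (.hyp h) (.thm t2))⟩,
      fun h => hG.mem_of_der hAx (.ds (.hyp h.2) (.ds (.hyp h.1) (.thm t3)))⟩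
  or A B := by
    have t1 : MBCLTheorem Ax (mimp A (.or A B)) :=
      thm_taut hAx (P := .or (.neg (.var 0)) (.or (.var 0) (.var 1)))
        (by intro v; simp only [PL.eval]; cases v 0 <;> cases v 1 <;> rfl)
        (fun i => if i = 0 then A else B)
    have t2 : MBCLTheorem Ax (mimp B (.or A B)) :=
      thm_taut hAx (P := .or (.neg (.var 1)) (.or (.var 0) (.var 1)))
        (by intro v; simp only [PL.eval]; cases v 0 <;> cases v 1 <;> rfl)
        (fun i => if i = 0 then A else B)
    have t3 : MBCLTheorem Ax (mimp (.or A B) (mimp (.neg A) B)) :=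
      thm_taut hAx (P := .or (.neg (.or (.var 0) (.var 1))) (.or (.neg (.neg (.var 0))) (.var 1)))
        (by intro v; simp only [PL.eval]; cases v 0 <;> cases v 1 <;> rfl)
        (fun i => if i = 0 then A else B)
    constructor
    · intro h
      by_cases hA : A ∈ G
      · exact .inl hA
      · exact .inr (hG.mem_of_der hAx
          (.ds (.hyp ((hG.neg_mem hAx A).2 hA)) (.ds (.hyp h) (.thm t3))))
    · rintro (h | h)
      · exact hG.mem_of_der hAx (.ds (.hyp h) (.thm t1))
      · exact hG.mem_of_der hAx (.ds (.hyp h) (.thm t2))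

theorem exists_mcs_not_mem {A : MForm} (h : ¬ MBCLTheorem Ax A) : ∃ G, MCS Ax G ∧ A ∉ G := by
  obtain ⟨G, h1, h2⟩ := exists_mcs (con_insert_neg hAx (G := ∅) fun d => h d.toThm)
  exact ⟨G, h2, (h2.neg_mem hAx A).1 (h1 (Set.mem_insert _ _))⟩

/-- If `¬A` were inconsistent with the formulas whose boxes lie in `G`, then `A` would follow from
these, and `Der.box` would put `□A` into `G`. -/
theorem MCS.exists_box (hG : MCS Ax G) {A : MForm} (h : box A ∉ G) :
    ∃ H, MCS Ax H ∧ (∀ Y, box Y ∈ G → Y ∈ H) ∧ A ∉ H := by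
  obtain ⟨H, h1, h2⟩ := exists_mcs (con_insert_neg hAx (G := {Y | box Y ∈ G})
    fun d => h (hG.mem_of_der hAx (d.box hAx)))
  exact ⟨H, h2, fun Y hY => h1 (Set.mem_insert_of_mem _ hY),
    (h2.neg_mem hAx A).1 (h1 (Set.mem_insert _ _))⟩

theorem MCS.dia_mem (hG : MCS Ax G) (A : MForm) : dia A ∈ G ↔ box (neg A) ∉ G := by
  have h : miff (dia A) (neg (box (neg A))) ∈ G :=
    hG.mem_of_der hAx (.thm (.ax (hAx _ (.dual A))))
  rw [(hG.cl hAx).miff] at h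
  exact h.trans (hG.neg_mem hAx _)

theorem MCS.exists_dia (hG : MCS Ax G) {A : MForm} (h : dia A ∈ G) :
    ∃ H, MCS Ax H ∧ (∀ Y, box Y ∈ G → Y ∈ H) ∧ A ∈ H := by
  obtain ⟨H, h1, h2, h3⟩ := hG.exists_box hAx ((hG.dia_mem hAx A).1 h)
  refine ⟨H, h1, h2, ?_⟩
  rw [h1.neg_mem hAx] at h3
  exact not_not.1 h3

theorem MCS.dia_of_mem (hG : MCS Ax G) {H : Set MForm} (hH : MCS Ax H)
    (h : ∀ Y, box Y ∈ G → Y ∈ H) {A : MForm} (hA : A ∈ H) : dia A ∈ G :=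
  (hG.dia_mem hAx A).2 fun h' => (hH.neg_mem hAx A).1 (h _ h') hA

end

end MForm
end Connexive

/-! ### Abstract systems, finite valuations and the models generated by them -/

namespace Connexive
namespace MForm
open Relation

/-- The formula with its leading negations removed. -/
def core : MForm → MForm
  | neg A => core A
  | A => A

/-- The number of leading negations. -/
def deg : MForm → ℕ
  | neg A => deg A + 1
  | _ => 0

/-- `n`-fold negation of a proposition. -/
def par : ℕ → Prop → Prop
  | 0, a => a
  | n + 1, a => ¬ par n a

/-- This recovers the truth value of a core from that of the formula. `Gen` needs the values of the
cores, while the recursion defining `val` may only call itself on the two sides of the implication.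
-/
theorem par_par (n : ℕ) (a : Prop) : par n (par n a) = a := by
  have h : ∀ (n : ℕ) (b : Prop), par n (¬ b) = ¬ par n b := by
    intro n b
    induction n with
    | zero => rfl
    | succ n ih => simp only [par, ih]
  induction n with
  | zero => rfl
  | succ n ih => simp only [par, h, ih, not_not]

theorem par_iff (n : ℕ) (a : Prop) : par n a ↔ (Even n ↔ a) := by
  induction n with
  | zero => simp [par]
  | succ n ih => rw [par, ih, Nat.even_add_one]; tauto

theorem core_negs (n : ℕ) (A : MForm) : core (negs n A) = core A := by
  induction n with
  | zero => rfl
  | succ n ih => exact ih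

theorem deg_negs (n : ℕ) (A : MForm) : deg (negs n A) = n + deg A := by
  induction n with
  | zero => exact (Nat.zero_add _).symm
  | succ n ih => rw [negs, deg, ih]; omega

theorem negs_deg_core (A : MForm) : negs (deg A) (core A) = A := by
  induction A with
  | neg A ih => simp only [deg, core, negs, ih]
  | _ => rfl

theorem negs_negs (i j : ℕ) (A : MForm) : negs i (negs j A) = negs (i + j) A := by
  induction i with
  | zero => rw [negs, Nat.zero_add]
  | succ i ih => rw [Nat.succ_add, negs, negs, ih]

theorem Cl.negs {T : MForm → Prop} (h : Cl T) (n : ℕ) (A : MForm) :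
    T (negs n A) ↔ par n (T A) := by
  induction n with
  | zero => rfl
  | succ n ih => rw [MForm.negs, h.neg, ih]; rfl

theorem Cl.core {T : MForm → Prop} (h : Cl T) (A : MForm) :
    T A ↔ par (deg A) (T (core A)) := by
  conv_lhs => rw [← negs_deg_core A]
  exact h.negs _ _

/-- The pairs `C, D` for which `C → D` is an instance of one of the axioms of Boethius. -/
inductive IsB : MForm → MForm → Prop
  | b1 (A B : MForm) : IsB (imp A B) (neg (imp A (neg B)))
  | b2 (A B : MForm) : IsB (imp A (neg B)) (neg (imp A B))

/-- Moves preserve cores, and the two sides of `A → ¬A` share theirs; so a Boethius seed never leads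
to a violation of Aristotle's axioms. -/
theorem IsB.core_ne {C D : MForm} (h : IsB C D) : core C ≠ core D := by
  have ne : ∀ B : MForm, B ≠ MForm.neg B := fun B hB => by
    have := congrArg deg hB
    simp [deg] at this
  cases h with
  | b1 A B => simp only [core, ne_eq, imp.injEq, true_and]; exact ne B
  | b2 A B => simp only [core, ne_eq, imp.injEq, true_and]; exact (ne B).symm

/-- A system extending `Ax_MBCL` by closure conditions `tr` that lead from one relating
implication to another, together with decidable descriptions `conf` of the pairs of implications
that are jointly refuted by Boethius' axioms, and `diag` of the implications refuted by
Aristotle's axioms. -/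
structure Sys where
  Ax : MForm → Prop
  tr : MForm → MForm → MForm → MForm → Prop
  conf : MForm → MForm → MForm → MForm → Prop
  diag : MForm → MForm → Prop
  base : ∀ A, AxMBCL A → Ax A
  ax_iff : ∀ T : MForm → Prop, Cl T → ((∀ A, Ax A → T A) ↔ (∀ A, AxMBCL A → T A) ∧
    ∀ C D C' D', tr C D C' D' → T (imp C D) → (T C' → T D') → T (imp C' D'))
  tr_core : ∀ {C D C' D'}, tr C D C' D' → core C' = core C ∧ core D' = core D
  tr_code : ∀ {C D C' D'}, tr C D C' D' → code C ≤ code C' ∧ code D ≤ code D'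
  conf_symm : ∀ {C D C' D'}, conf C D C' D' → conf C' D' C D
  conf_code : ∀ {C D A B D'}, conf C D (imp A B) D' → code (imp A B) ≤ code C
  conf_sound : ∀ T : MForm → Prop, Cl T → (∀ A, Ax A → T A) → ∀ C D C' D', conf C D C' D' →
    T (imp C D) → ¬ T (imp C' D')
  diag_sound : ∀ T : MForm → Prop, Cl T → (∀ A, Ax A → T A) → ∀ C D, diag C D → ¬ T (imp C D)
  conf_of_path : ∀ {C D C' D' A B},
    ReflTransGen (fun P Q : MForm × MForm => tr P.1 P.2 Q.1 Q.2) (C, D) (A, B) →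
    ReflTransGen (fun P Q : MForm × MForm => tr P.1 P.2 Q.1 Q.2) (C', D') (A, neg B) →
    conf C D C' D'
  diag_of_path : ∀ {T : MForm → Prop} {C D A B}, Cl T → (T C → T D) →
    ReflTransGen (fun P Q : MForm × MForm => tr P.1 P.2 Q.1 Q.2 ∧ (T Q.1 → T Q.2))
      (C, D) (A, B) → (B = neg A ∨ A = neg B) → diag C D
  tr_prim : PrimrecPred fun q : MForm × MForm × MForm × MForm => tr q.1 q.2.1 q.2.2.1 q.2.2.2
  conf_prim : PrimrecPred fun q : MForm × MForm × MForm × MForm => conf q.1 q.2.1 q.2.2.1 q.2.2.2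
  diag_prim : PrimrecPred fun q : MForm × MForm => diag q.1 q.2

/-- Truth of the formula `A` in the finite valuation with binary code `w`. -/
def bit (w : ℕ) (A : MForm) : Prop := w.testBit (code A) = true

/-- `w` codes a valuation of the formulas with Gödel number below `N` that can be extended. -/
structure Good (Y : Sys) (N w : ℕ) : Prop where
  neg : ∀ A, code (neg A) < N → (bit w (neg A) ↔ ¬ bit w A)
  and : ∀ A B, code (and A B) < N → (bit w (and A B) ↔ bit w A ∧ bit w B)
  or : ∀ A B, code (or A B) < N → (bit w (or A B) ↔ bit w A ∨ bit w B)
  impl : ∀ C D, bit w (imp C D) → bit w C → bit w D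
  isB : ∀ C D, IsB C D → code (imp C D) < N → bit w (imp C D)
  tr : ∀ C D C' D', Y.tr C D C' D' → code (imp C' D') < N → bit w (imp C D) →
    (bit w C' → bit w D') → bit w (imp C' D')
  conf : ∀ C D C' D', bit w (imp C D) → bit w (imp C' D') → ¬ Y.conf C D C' D'
  confB : ∀ C D C' D', bit w (imp C D) → IsB C' D' → ¬ Y.conf C D C' D'
  diag : ∀ C D, bit w (imp C D) → ¬ Y.diag C D

/-- Accessibility between finite valuations. -/
def Acc (N w u : ℕ) : Prop :=
  ∀ A, (bit w (box A) → bit u A) ∧ (code (dia A) < N → bit u A → bit w (dia A))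

/-- `S` is a set of extendable finite valuations in which all modal demands are met. -/
structure Coh (Y : Sys) (N : ℕ) (S : Set ℕ) : Prop where
  lt : ∀ w ∈ S, w < 2 ^ N
  good : ∀ w ∈ S, Good Y N w
  box : ∀ w ∈ S, ∀ A, code (box A) < N → ¬ bit w (box A) → ∃ u ∈ S, Acc N w u ∧ ¬ bit u A
  dia : ∀ w ∈ S, ∀ A, bit w (dia A) → ∃ u ∈ S, Acc N w u ∧ bit u A

/-- `C → D` is generated in `w` when the cores of `C` and `D` have the truth values `a` and `b`. -/
def Gen (Y : Sys) (w : ℕ) (a b : Prop) (C D : MForm) : Prop :=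
  ∃ P : MForm × MForm, (bit w (imp P.1 P.2) ∨ IsB P.1 P.2) ∧
    (par (deg P.1) a → par (deg P.2) b) ∧
    ReflTransGen (fun P Q : MForm × MForm =>
      Y.tr P.1 P.2 Q.1 Q.2 ∧ (par (deg Q.1) a → par (deg Q.2) b)) P (C, D)

/-- The Kripke valuation on a set of finite valuations. -/
def val (Y : Sys) (N : ℕ) (S : Set ℕ) : MForm → ℕ → Prop
  | var i, w => bit w (var i)
  | neg A, w => ¬ val Y N S A w
  | and A B, w => val Y N S A w ∧ val Y N S B w
  | or A B, w => val Y N S A w ∨ val Y N S B w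
  | imp C D, w => Gen Y w (par (deg C) (val Y N S C w)) (par (deg D) (val Y N S D w)) C D
  | box A, w => ∀ u ∈ S, Acc N w u → val Y N S A u
  | dia A, w => ∃ u ∈ S, Acc N w u ∧ val Y N S A u

variable {Y : Sys} {N : ℕ} {S : Set ℕ}

theorem val_cl (w : ℕ) : Cl (fun A => val Y N S A w) where
  neg _ := Iff.rfl
  and _ _ := Iff.rfl
  or _ _ := Iff.rfl

theorem path_tr {ok : MForm × MForm → Prop} {P Q : MForm × MForm}
    (h : ReflTransGen (fun P Q : MForm × MForm => Y.tr P.1 P.2 Q.1 Q.2 ∧ ok Q) P Q) :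
    ReflTransGen (fun P Q : MForm × MForm => Y.tr P.1 P.2 Q.1 Q.2) P Q :=
  h.lift id fun _ _ h => h.1

theorem path_core {P Q : MForm × MForm}
    (h : ReflTransGen (fun P Q : MForm × MForm => Y.tr P.1 P.2 Q.1 Q.2) P Q) :
    core Q.1 = core P.1 ∧ core Q.2 = core P.2 := by
  induction h with
  | refl => exact ⟨rfl, rfl⟩
  | tail _ h ih => exact ⟨(Y.tr_core h).1.trans ih.1, (Y.tr_core h).2.trans ih.2⟩

/-- All pairs on a path to `(C, D)` have the cores of `C` and `D`, so the two truth values of these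
cores settle every side condition along the path. -/
theorem gen_iff {T : MForm → Prop} (hT : Cl T) (w : ℕ) (C D : MForm) :
    Gen Y w (par (deg C) (T C)) (par (deg D) (T D)) C D ↔
      ∃ P : MForm × MForm, (bit w (imp P.1 P.2) ∨ IsB P.1 P.2) ∧ (T P.1 → T P.2) ∧
        ReflTransGen (fun P Q : MForm × MForm =>
          Y.tr P.1 P.2 Q.1 Q.2 ∧ (T Q.1 → T Q.2)) P (C, D) := by
  have e : ∀ A, par (deg A) (T A) = T (core A) := fun A => by
    rw [propext (hT.core A), par_par]
  have key : ∀ Q : MForm × MForm,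
      ReflTransGen (fun P Q : MForm × MForm => Y.tr P.1 P.2 Q.1 Q.2) Q (C, D) →
      ((par (deg Q.1) (T (core C)) → par (deg Q.2) (T (core D))) ↔ (T Q.1 → T Q.2)) := by
    intro Q hQ
    obtain ⟨h1, h2⟩ := path_core hQ
    simp only at h1 h2
    rw [h1, h2, ← hT.core, ← hT.core]
  rw [e, e]
  refine exists_congr fun P => and_congr_right fun h0 => ?_
  constructor
  · rintro ⟨h1, h2⟩
    refine ⟨(key P (path_tr h2)).1 h1, ?_⟩
    clear h0 h1
    -- Induction from the head keeps the endpoint `(C, D)` fixed, as `key` requires.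
    induction h2 using ReflTransGen.head_induction_on with
    | refl => exact .refl
    | head h h' ih =>
      exact .head ⟨h.1, (key _ (path_tr h')).1 h.2⟩ ih
  · rintro ⟨h1, h2⟩
    refine ⟨(key P (path_tr h2)).2 h1, ?_⟩
    clear h0 h1
    induction h2 using ReflTransGen.head_induction_on with
    | refl => exact .refl
    | head h h' ih =>
      exact .head ⟨h.1, (key _ (path_tr h')).2 h.2⟩ ih

theorem val_imp (C D : MForm) (w : ℕ) : val Y N S (imp C D) w ↔
    ∃ P : MForm × MForm, (bit w (imp P.1 P.2) ∨ IsB P.1 P.2) ∧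
      (val Y N S P.1 w → val Y N S P.2 w) ∧
      ReflTransGen (fun P Q : MForm × MForm => Y.tr P.1 P.2 Q.1 Q.2 ∧
        (val Y N S Q.1 w → val Y N S Q.2 w)) P (C, D) :=
  gen_iff (val_cl w) w C D

theorem code_lt_neg (A : MForm) : code A < code (neg A) := by simp only [code]; omega
theorem code_lt_box (A : MForm) : code A < code (box A) := by simp only [code]; omega
theorem code_lt_dia (A : MForm) : code A < code (dia A) := by simp only [code]; omega
theorem code_lt_and (A B : MForm) : code A < code (and A B) ∧ code B < code (and A B) := by
  have h1 := Nat.left_le_pair (code A) (code B)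
  have h2 := Nat.right_le_pair (code A) (code B)
  simp only [code]; omega
theorem code_lt_or (A B : MForm) : code A < code (or A B) ∧ code B < code (or A B) := by
  have h1 := Nat.left_le_pair (code A) (code B)
  have h2 := Nat.right_le_pair (code A) (code B)
  simp only [code]; omega
theorem code_lt_imp (A B : MForm) : code A < code (imp A B) ∧ code B < code (imp A B) := by
  have h1 := Nat.left_le_pair (code A) (code B)
  have h2 := Nat.right_le_pair (code A) (code B)
  simp only [code]; omega

theorem code_imp_le {C D C' D' : MForm} (h1 : code C ≤ code C') (h2 : code D ≤ code D') :
    code (imp C D) ≤ code (imp C' D') := by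
  have h : Nat.pair (code C) (code D) ≤ Nat.pair (code C') (code D') := by
    rcases h1.lt_or_eq with h1 | h1
    · rcases h2.lt_or_eq with h2 | h2
      · exact ((Nat.pair_lt_pair_left _ h1).trans (Nat.pair_lt_pair_right _ h2)).le
      · rw [h2]; exact (Nat.pair_lt_pair_left _ h1).le
    · rw [h1]
      rcases h2.lt_or_eq with h2 | h2
      · exact (Nat.pair_lt_pair_right _ h2).le
      · rw [h2]
  simp only [code]; omega

theorem code_lt_of_bit {w : ℕ} (hw : w < 2 ^ N) {A : MForm} (h : bit w A) : code A < N := by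
  by_contra hN
  have : w.testBit (code A) = false :=
    Nat.testBit_lt_two_pow (hw.trans_le (Nat.pow_le_pow_right (by norm_num) (not_lt.1 hN)))
  rw [bit, this] at h
  exact Bool.false_ne_true h

theorem path_code {P Q : MForm × MForm}
    (h : ReflTransGen (fun P Q : MForm × MForm => Y.tr P.1 P.2 Q.1 Q.2) P Q) :
    code P.1 ≤ code Q.1 ∧ code P.2 ≤ code Q.2 := by
  induction h with
  | refl => exact ⟨le_rfl, le_rfl⟩
  | tail _ h ih => exact ⟨ih.1.trans (Y.tr_code h).1, ih.2.trans (Y.tr_code h).2⟩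

/-- In the case of an implication, codes grow along the generating path, so the whole path stays
below `N`, where the closure conditions of `Good` carry truth from the seed to the end. -/
theorem val_eq (h : Coh Y N S) (A : MForm) : ∀ w ∈ S, code A < N →
    (val Y N S A w ↔ bit w A) := by
  induction hn : code A using Nat.strong_induction_on generalizing A with
  | _ n ih =>
  subst hn
  intro w hw hA
  cases A with
  | var i => exact Iff.rfl
  | neg A =>
    have hA' := code_lt_neg A
    rw [val, ih _ hA' A rfl w hw (hA'.trans hA), (h.good w hw).neg A hA]
  | and A B =>
    have hA' := code_lt_and A B
    rw [val, ih _ hA'.1 A rfl w hw (hA'.1.trans hA), ih _ hA'.2 B rfl w hw (hA'.2.trans hA),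
      (h.good w hw).and A B hA]
  | or A B =>
    have hA' := code_lt_or A B
    rw [val, ih _ hA'.1 A rfl w hw (hA'.1.trans hA), ih _ hA'.2 B rfl w hw (hA'.2.trans hA),
      (h.good w hw).or A B hA]
  | box A =>
    have hA' := code_lt_box A
    rw [val]
    constructor
    · intro h1
      by_contra h2
      obtain ⟨u, hu, h3, h4⟩ := h.box w hw A hA h2
      exact h4 ((ih _ hA' A rfl u hu (hA'.trans hA)).1 (h1 u hu h3))
    · exact fun h1 u hu h2 => (ih _ hA' A rfl u hu (hA'.trans hA)).2 ((h2 A).1 h1)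
  | dia A =>
    have hA' := code_lt_dia A
    rw [val]
    constructor
    · rintro ⟨u, hu, h2, h3⟩
      exact (h2 A).2 hA ((ih _ hA' A rfl u hu (hA'.trans hA)).1 h3)
    · intro h1
      obtain ⟨u, hu, h2, h3⟩ := h.dia w hw A h1
      exact ⟨u, hu, h2, (ih _ hA' A rfl u hu (hA'.trans hA)).2 h3⟩
  | imp C D =>
    have hC := (code_lt_imp C D).1
    have hD := (code_lt_imp C D).2
    have key : ∀ B, code B < code (imp C D) → (val Y N S B w ↔ bit w B) :=
      fun B hB => ih _ hB B rfl w hw (hB.trans hA)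
    rw [val_imp]
    constructor
    · rintro ⟨P, h1, h2, h3⟩
      have h0 := path_code (path_tr h3)
      have hP : bit w (imp P.1 P.2) :=
        h1.elim id fun h1 => (h.good w hw).isB _ _ h1 ((code_imp_le h0.1 h0.2).trans_lt hA)
      clear h0 h1 h2
      have step : ∀ Q, ReflTransGen (fun P Q : MForm × MForm => Y.tr P.1 P.2 Q.1 Q.2 ∧
          (val Y N S Q.1 w → val Y N S Q.2 w)) P Q → code Q.1 ≤ code C → code Q.2 ≤ code D →
          bit w (imp Q.1 Q.2) := by
        intro Q hQ
        induction hQ with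
        | refl => exact fun _ _ => hP
        | tail _ h4 ih' =>
          intro h5 h6
          have h7 := Y.tr_code h4.1
          refine (h.good w hw).tr _ _ _ _ h4.1 ((code_imp_le h5 h6).trans_lt hA)
            (ih' (h7.1.trans h5) (h7.2.trans h6)) ?_
          rw [← key _ (h5.trans_lt hC), ← key _ (h6.trans_lt hD)]
          exact h4.2
      exact step (C, D) h3 le_rfl le_rfl
    · intro h1
      refine ⟨(C, D), .inl h1, ?_, .refl⟩
      rw [key C hC, key D hD]
      exact (h.good w hw).impl C D h1

/-- The side condition at the last pair of the generating path is the material implication itself.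
-/
theorem val_impl {C D : MForm} {w : ℕ} (h : val Y N S (imp C D) w) (hC : val Y N S C w) :
    val Y N S D w := by
  obtain ⟨P, -, h1, h2⟩ := (val_imp C D w).1 h
  rcases ReflTransGen.cases_tail h2 with h3 | ⟨Q, -, h3⟩
  · rw [← h3] at h1; exact h1 hC
  · exact h3.2 hC

theorem val_isB {C D : MForm} (hCD : IsB C D) {w : ℕ} (h : val Y N S C w → val Y N S D w) :
    val Y N S (imp C D) w :=
  (val_imp C D w).2 ⟨(C, D), .inr hCD, h, .refl⟩

/-- The seeds of the two implications conflict. Each is a true bit or a Boethius instance; as such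
instances may exceed `N`, `confB` and `hY` put no bound on them. -/
theorem val_boethius (h : Coh Y N S)
    (hY : ∀ C D C' D', IsB C D → IsB C' D' → ¬ Y.conf C D C' D') {A B : MForm} {w : ℕ}
    (hw : w ∈ S) (h1 : val Y N S (imp A B) w) (h2 : val Y N S (imp A (neg B)) w) : False := by
  obtain ⟨P, p1, -, p3⟩ := (val_imp A B w).1 h1
  obtain ⟨Q, q1, -, q3⟩ := (val_imp A (neg B) w).1 h2
  have hc := Y.conf_of_path (path_tr p3)
    (path_tr q3)
  rcases p1 with p1 | p1 <;> rcases q1 with q1 | q1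
  · exact (h.good w hw).conf _ _ _ _ p1 q1 hc
  · exact (h.good w hw).confB _ _ _ _ p1 q1 hc
  · exact (h.good w hw).confB _ _ _ _ q1 p1 (Y.conf_symm hc)
  · exact hY _ _ _ _ p1 q1 hc

theorem val_aristotle (h : Coh Y N S) {A B : MForm} (hAB : B = neg A ∨ A = neg B) {w : ℕ}
    (hw : w ∈ S) : ¬ val Y N S (imp A B) w := by
  intro h1
  obtain ⟨P, p1, p2, p3⟩ := (val_imp A B w).1 h1
  rcases p1 with p1 | p1
  · exact (h.good w hw).diag _ _ p1 (Y.diag_of_path (val_cl w) p2 p3 hAB)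
  · obtain ⟨h2, h3⟩ := path_core (path_tr p3)
    apply p1.core_ne
    rw [← h2, ← h3]
    rcases hAB with rfl | rfl <;> rfl

theorem val_ax (h : Coh Y N S) (hY : ∀ C D C' D', IsB C D → IsB C' D' → ¬ Y.conf C D C' D')
    {w : ℕ} (hw : w ∈ S) {A : MForm} (hA : Y.Ax A) : val Y N S A w := by
  have cl : Cl (fun A => val Y N S A w) := val_cl w
  refine (Y.ax_iff _ cl).2 ⟨?_, ?_⟩ A hA
  · intro A hA
    cases hA with
    | cpl P s hP => exact cl.inst hP s
    | a1 A => exact val_aristotle h (.inl rfl) hw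
    | a2 A => exact val_aristotle h (.inr rfl) hw
    -- A Boethius instance is a seed once its material counterpart holds, and that counterpart is
    -- the exclusion of `A → B` together with `A → ¬B`.
    | b1 A B => exact val_isB (.b1 A B) fun h1 h2 => val_boethius h hY hw h1 h2
    | b2 A B => exact val_isB (.b2 A B) fun h1 h2 => val_boethius h hY hw h2 h1
    | impl A B => exact (cl.mimp _ _).2 fun h1 => (cl.mimp _ _).2 fun h2 => val_impl h1 h2
    | dual A =>
      refine (cl.miff _ _).2 ?_
      simp only [val, not_forall, not_not, exists_prop]
    | kk A B =>
      refine (cl.mimp _ _).2 fun h1 => (cl.mimp _ _).2 fun h2 => ?_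
      exact fun u hu hwu => ((val_cl u).mimp A B).1 (h1 u hu hwu) (h2 u hu hwu)
  · intro C D C' D' ht h1 h2
    obtain ⟨P, p1, p2, p3⟩ := (val_imp C D w).1 h1
    exact (val_imp C' D' w).2 ⟨P, p1, p2, p3.tail ⟨ht, h2⟩⟩

theorem val_thm (h : Coh Y N S) (hY : ∀ C D C' D', IsB C D → IsB C' D' → ¬ Y.conf C D C' D')
    {A : MForm} (hA : MBCLTheorem Y.Ax A) : ∀ w ∈ S, val Y N S A w := by
  induction hA with
  | ax hA => exact fun w hw => val_ax h hY hw hA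
  | ds _ _ i1 i2 => exact fun w hw => ((val_cl w).mimp _ _).1 (i2 w hw) (i1 w hw)
  | nec _ ih => exact fun w _ u hu _ => ih u hu

/-! ### Completeness by truncated maximal consistent sets -/

/-- The finite valuations realized by maximal consistent sets. -/
def canon (Y : Sys) (N : ℕ) : Set ℕ :=
  {w | w < 2 ^ N ∧ ∃ G, MCS Y.Ax G ∧ ∀ A, code A < N → (bit w A ↔ A ∈ G)}

theorem exists_bits (N : ℕ) (p : ℕ → Prop) :
    ∃ w < 2 ^ N, ∀ x < N, (w.testBit x = true ↔ p x) := by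
  classical
  refine ⟨Nat.ofBits fun i : Fin N => decide (p i), Nat.ofBits_lt_two_pow _, fun x hx => ?_⟩
  rw [Nat.testBit_ofBits_lt _ _ hx, decide_eq_true_iff]

theorem exists_canon {G : Set MForm} (hG : MCS Y.Ax G) (N : ℕ) :
    ∃ w ∈ canon Y N, ∀ A, code A < N → (bit w A ↔ A ∈ G) := by
  obtain ⟨w, h1, h2⟩ := exists_bits N fun x => ofCode x ∈ G
  have h3 : ∀ A, code A < N → (bit w A ↔ A ∈ G) := fun A hA => by
    rw [bit, h2 _ hA, ofCode_code]
  exact ⟨w, ⟨h1, G, hG, h3⟩, h3⟩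

theorem MCS.ax_mem {G : Set MForm} (hG : MCS Y.Ax G) {A : MForm} (hA : Y.Ax A) : A ∈ G :=
  hG.mem_of_der Y.base (.thm (.ax hA))

theorem MCS.isB_mem {G : Set MForm} (hG : MCS Y.Ax G) {C D : MForm} (h : IsB C D) :
    imp C D ∈ G := by
  cases h with
  | b1 A B => exact hG.ax_mem (Y.base _ (.b1 A B))
  | b2 A B => exact hG.ax_mem (Y.base _ (.b2 A B))

theorem good_of_mcs {G : Set MForm} (hG : MCS Y.Ax G) {w : ℕ} (hw : w < 2 ^ N)
    (h : ∀ A, code A < N → (bit w A ↔ A ∈ G)) : Good Y N w := by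
  have cl : Cl (· ∈ G) := hG.cl Y.base
  have hax : ∀ A, Y.Ax A → A ∈ G := fun A => hG.ax_mem
  have htr := ((Y.ax_iff _ cl).1 hax).2
  have hbit : ∀ {A}, bit w A → A ∈ G := fun hA => (h _ (code_lt_of_bit hw hA)).1 hA
  constructor
  · intro A hA
    rw [h _ hA, h _ ((code_lt_neg A).trans hA)]; exact cl.neg A
  · intro A B hA
    rw [h _ hA, h _ ((code_lt_and A B).1.trans hA), h _ ((code_lt_and A B).2.trans hA)]
    exact cl.and A B
  · intro A B hA
    rw [h _ hA, h _ ((code_lt_or A B).1.trans hA), h _ ((code_lt_or A B).2.trans hA)]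
    exact cl.or A B
  · intro C D h1 h2
    have h3 := code_lt_of_bit hw h1
    rw [h _ ((code_lt_imp C D).2.trans h3)]
    exact (cl.mimp _ _).1 ((cl.mimp _ _).1 (hax _ (Y.base _ (.impl C D))) (hbit h1)) (hbit h2)
  · exact fun C D h1 h2 => (h _ h2).2 (hG.isB_mem h1)
  · intro C D C' D' h1 h2 h3 h4
    rw [h _ ((code_lt_imp C' D').1.trans h2), h _ ((code_lt_imp C' D').2.trans h2)] at h4
    exact (h _ h2).2 (htr _ _ _ _ h1 (hbit h3) h4)
  · exact fun C D C' D' h1 h2 h3 => Y.conf_sound _ cl hax _ _ _ _ h3 (hbit h1) (hbit h2)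
  · exact fun C D C' D' h1 h2 h3 =>
      Y.conf_sound _ cl hax _ _ _ _ h3 (hbit h1) (hG.isB_mem h2)
  · exact fun C D h1 h2 => Y.diag_sound _ cl hax _ _ h2 (hbit h1)

theorem canon_coh (Y : Sys) (N : ℕ) : Coh Y N (canon Y N) := by
  have acc : ∀ {w u : ℕ} {G H : Set MForm}, w < 2 ^ N → MCS Y.Ax G → MCS Y.Ax H →
      (∀ A, code A < N → (bit w A ↔ A ∈ G)) → (∀ A, code A < N → (bit u A ↔ A ∈ H)) →
      (∀ A, box A ∈ G → A ∈ H) → Acc N w u := by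
    intro w u G H hw hG hH h1 h2 h3 A
    constructor
    · intro h4
      have h5 := code_lt_of_bit hw h4
      exact (h2 _ ((code_lt_box A).trans h5)).2 (h3 _ ((h1 _ h5).1 h4))
    · intro h4 h5
      exact (h1 _ h4).2 (hG.dia_of_mem Y.base hH h3 ((h2 _ ((code_lt_dia A).trans h4)).1 h5))
  constructor
  · exact fun w hw => hw.1
  · rintro w ⟨hw, G, hG, h⟩
    exact good_of_mcs hG hw h
  · rintro w ⟨hw, G, hG, h⟩ A hA h1
    obtain ⟨H, hH, h2, h3⟩ := hG.exists_box Y.base (fun h' => h1 ((h _ hA).2 h'))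
    obtain ⟨u, hu, h4⟩ := exists_canon hH N
    exact ⟨u, hu, acc hw hG hH h h4 h2, fun h' => h3 ((h4 _ ((code_lt_box A).trans hA)).1 h')⟩
  · rintro w ⟨hw, G, hG, h⟩ A h1
    have hA := code_lt_of_bit hw h1
    obtain ⟨H, hH, h2, h3⟩ := hG.exists_dia Y.base ((h _ hA).1 h1)
    obtain ⟨u, hu, h4⟩ := exists_canon hH N
    exact ⟨u, hu, acc hw hG hH h h4 h2, (h4 _ ((code_lt_dia A).trans hA)).2 h3⟩

/-- The set of numbers below `2 ^ N` coded by `s`. -/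
def bits (N s : ℕ) : Set ℕ := {w | w < 2 ^ N ∧ s.testBit w = true}

/-- The bound `code A + 1` is the least for which `A` itself is below it. A family of numbers below
`2 ^ N` is itself coded by the bits of a number below `2 ^ 2 ^ N`. -/
theorem thm_iff (Y : Sys) (hY : ∀ C D C' D', IsB C D → IsB C' D' → ¬ Y.conf C D C' D')
    (A : MForm) : MBCLTheorem Y.Ax A ↔ ∀ s < 2 ^ 2 ^ (code A + 1),
      Coh Y (code A + 1) (bits (code A + 1) s) → ∀ w ∈ bits (code A + 1) s, bit w A := by
  constructor
  · exact fun hA s _ hs w hw => (val_eq hs A w hw (Nat.lt_succ_self _)).1 (val_thm hs hY hA w hw)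
  · intro h
    by_contra hA
    obtain ⟨G, hG, hAG⟩ := exists_mcs_not_mem Y.base hA
    obtain ⟨w, hw, hwG⟩ := exists_canon hG (code A + 1)
    obtain ⟨s, hs, h1⟩ := exists_bits (2 ^ (code A + 1)) (· ∈ canon Y (code A + 1))
    have h2 : bits (code A + 1) s = canon Y (code A + 1) := by
      ext u
      exact ⟨fun hu => (h1 u hu.1).1 hu.2, fun hu => ⟨hu.1, (h1 u hu.1).2 hu⟩⟩
    have h3 := h s hs (h2 ▸ canon_coh Y _) w (h2 ▸ hw)
    exact hAG ((hwG A (Nat.lt_succ_self _)).1 h3)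

/-- Every maximal consistent set would contain both conflicting instances, so there is none. -/
theorem thm_of_conf (Y : Sys) {C D C' D' : MForm} (h1 : IsB C D) (h2 : IsB C' D')
    (h : Y.conf C D C' D') (A : MForm) : MBCLTheorem Y.Ax A := by
  by_contra hA
  obtain ⟨G, hG, -⟩ := exists_mcs_not_mem Y.base hA
  exact Y.conf_sound _ (hG.cl Y.base) (fun A => hG.ax_mem) _ _ _ _ h (hG.isB_mem h1)
    (hG.isB_mem h2)

end MForm
end Connexive

/-! ### Primitive recursiveness of the finite search -/

namespace Connexive
open Primrec

section
variable {α : Type*} [Primcodable α]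

theorem primrec_forall_lt {p : α → ℕ → Prop} {f : α → ℕ} (hf : Primrec f)
    (hp : PrimrecPred fun q : α × ℕ => p q.1 q.2) : PrimrecPred fun a => ∀ x < f a, p a x :=
  ((PrimrecRel.forall_mem_list (R := fun x a => p a x) (hp.comp (Primrec.snd.pair Primrec.fst))).comp
    (Primrec.list_range.comp hf) Primrec.id).of_eq fun a => by simp

theorem primrec_exists_lt {p : α → ℕ → Prop} {f : α → ℕ} (hf : Primrec f)
    (hp : PrimrecPred fun q : α × ℕ => p q.1 q.2) : PrimrecPred fun a => ∃ x < f a, p a x :=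
  ((PrimrecRel.exists_mem_list (R := fun x a => p a x) (hp.comp (Primrec.snd.pair Primrec.fst))).comp
    (Primrec.list_range.comp hf) Primrec.id).of_eq fun a => by simp

theorem primrec_imp {p q : α → Prop} (hp : PrimrecPred p) (hq : PrimrecPred q) :
    PrimrecPred fun a => p a → q a :=
  (hp.not.or hq).of_eq fun _ => imp_iff_not_or.symm

theorem primrec_iff {p q : α → Prop} (hp : PrimrecPred p) (hq : PrimrecPred q) :
    PrimrecPred fun a => p a ↔ q a :=
  ((primrec_imp hp hq).and (primrec_imp hq hp)).of_eq fun _ => iff_iff_implies_and_implies.symm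

theorem primrec_pow : Primrec₂ ((· ^ ·) : ℕ → ℕ → ℕ) :=
  Primrec₂.unpaired'.1 Nat.Primrec.pow

theorem primrec_testBit : PrimrecRel fun w x : ℕ => w.testBit x = true :=
  (Primrec.eq.comp (nat_mod.comp (nat_div.comp Primrec.fst
    (primrec_pow.comp (Primrec.const 2) Primrec.snd)) (Primrec.const 2)) (Primrec.const 1)).of_eq
    fun q => by simp [Nat.testBit_eq_decide_div_mod_eq]

namespace MForm

theorem primrec_code : Primrec code := Primrec.of_equiv (e := codeEquiv)

theorem primrec_ofCode : Primrec ofCode := Primrec.of_equiv_symm (e := codeEquiv)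

theorem primrec_of_code {f : α → MForm} (h : Primrec fun a => code (f a)) : Primrec f :=
  (Primrec.of_equiv_iff codeEquiv).1 h

theorem primrec_neg : Primrec neg :=
  primrec_of_code (nat_add.comp (nat_mul.comp (.const 7) primrec_code) (.const 1))

theorem primrec_box : Primrec box :=
  primrec_of_code (nat_add.comp (nat_mul.comp (.const 7) primrec_code) (.const 5))

theorem primrec_dia : Primrec dia :=
  primrec_of_code (nat_add.comp (nat_mul.comp (.const 7) primrec_code) (.const 6))

theorem primrec_code_pair : Primrec₂ fun A B : MForm => Nat.pair (code A) (code B) :=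
  Primrec₂.natPair.comp (primrec_code.comp .fst) (primrec_code.comp .snd)

theorem primrec_and : Primrec₂ and :=
  primrec_of_code (nat_add.comp (nat_mul.comp (.const 7) primrec_code_pair) (.const 2))

theorem primrec_or : Primrec₂ or :=
  primrec_of_code (nat_add.comp (nat_mul.comp (.const 7) primrec_code_pair) (.const 3))

theorem primrec_imp_form : Primrec₂ imp :=
  primrec_of_code (nat_add.comp (nat_mul.comp (.const 7) primrec_code_pair) (.const 4))

theorem primrec_negs : Primrec₂ negs :=
  (Primrec.nat_iterate (f := Prod.fst) (g := Prod.snd) (h := fun _ A => neg A) .fst .snd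
    (primrec_neg.comp .snd)).of_eq fun q => by
      obtain ⟨n, A⟩ := q
      induction n with
      | zero => rfl
      | succ n ih => rw [Function.iterate_succ_apply', ih]; rfl

theorem primrec_bit : PrimrecRel bit :=
  primrec_testBit.comp .fst (primrec_code.comp .snd)

theorem primrec_forall {p : α → MForm → Prop} {f : α → ℕ} (hf : Primrec f)
    (hp : PrimrecPred fun q : α × MForm => p q.1 q.2) :
    PrimrecPred fun a => ∀ A, code A < f a → p a A :=
  (primrec_forall_lt (p := fun a x => p a (ofCode x)) hf
    (hp.comp (Primrec.fst.pair (primrec_ofCode.comp .snd)))).of_eq fun a =>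
      ⟨fun h A hA => by have := h _ hA; rwa [ofCode_code] at this,
        fun h x hx => h _ (by rwa [code_ofCode])⟩

theorem primrec_exists {p : α → MForm → Prop} {f : α → ℕ} (hf : Primrec f)
    (hp : PrimrecPred fun q : α × MForm => p q.1 q.2) :
    PrimrecPred fun a => ∃ A, code A < f a ∧ p a A :=
  (primrec_exists_lt (p := fun a x => p a (ofCode x)) hf
    (hp.comp (Primrec.fst.pair (primrec_ofCode.comp .snd)))).of_eq fun a =>
      ⟨fun ⟨x, hx, h⟩ => ⟨ofCode x, by rwa [code_ofCode], h⟩,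
        fun ⟨A, hA, h⟩ => ⟨code A, hA, by rwa [ofCode_code]⟩⟩

/-- A number below `2 ^ N` has no bits from `N` on, so bounded quantifiers suffice. This is why the
bound on `w` accompanies the predicates shown primitive recursive below. -/
theorem acc_iff {N w u : ℕ} (hw : w < 2 ^ N) : Acc N w u ↔ ∀ A, code A < N →
    (bit w (box A) → bit u A) ∧ (code (dia A) < N → bit u A → bit w (dia A)) :=
  ⟨fun h A _ => h A, fun h A =>
    ⟨fun h1 => (h A ((code_lt_box A).trans (code_lt_of_bit hw h1))).1 h1,
      fun h1 => (h A ((code_lt_dia A).trans h1)).2 h1⟩⟩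

theorem primrec_acc : PrimrecPred fun q : ℕ × ℕ × ℕ => q.2.1 < 2 ^ q.1 ∧ Acc q.1 q.2.1 q.2.2 := by
  refine PrimrecPred.of_eq ?_ fun q => and_congr_right fun hq => (acc_iff hq).symm
  repeat' first
    | with_reducible exact Primrec.fst
    | with_reducible exact Primrec.snd
    | with_reducible exact Primrec.id
    | with_reducible exact Primrec.const _
    | with_reducible refine primrec_forall ?_ ?_
    | with_reducible refine PrimrecPred.and ?_ ?_
    | with_reducible refine primrec_imp ?_ ?_
    | with_reducible refine Primrec.nat_lt.comp ?_ ?_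
    | with_reducible refine primrec_bit.comp ?_ ?_
    | with_reducible refine primrec_code.comp ?_
    | with_reducible refine primrec_box.comp ?_
    | with_reducible refine primrec_dia.comp ?_
    | with_reducible refine primrec_pow.comp ?_ ?_
    | with_reducible refine Primrec.fst.comp ?_
    | with_reducible refine Primrec.snd.comp ?_

theorem primrec_isB : PrimrecRel IsB := by
  have h : PrimrecPred fun q : MForm × MForm => ∃ A, code A < code q.1 ∧ ∃ B, code B < code q.1 ∧
      ((q.1 = imp A B ∧ q.2 = neg (imp A (neg B))) ∨
        (q.1 = imp A (neg B) ∧ q.2 = neg (imp A B))) := by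
    repeat' first
      | with_reducible exact Primrec.fst
      | with_reducible exact Primrec.snd
      | with_reducible exact Primrec.id
      | with_reducible exact Primrec.const _
      | with_reducible refine primrec_exists ?_ ?_
      | with_reducible refine PrimrecPred.and ?_ ?_
      | with_reducible refine PrimrecPred.or ?_ ?_
      | with_reducible refine Primrec.eq.comp ?_ ?_
      | with_reducible refine primrec_code.comp ?_
      | with_reducible refine primrec_neg.comp ?_
      | with_reducible refine primrec_imp_form.comp ?_ ?_
      | with_reducible refine Primrec.fst.comp ?_
      | with_reducible refine Primrec.snd.comp ?_
  refine h.of_eq fun q => ⟨?_, ?_⟩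
  · rintro ⟨A, -, B, -, ⟨h1, h2⟩ | ⟨h1, h2⟩⟩
    · rw [h1, h2]; exact .b1 A B
    · rw [h1, h2]; exact .b2 A B
  · obtain ⟨C, D⟩ := q
    rintro (⟨A, B⟩ | ⟨A, B⟩)
    · exact ⟨A, (code_lt_imp A B).1, B, (code_lt_imp A B).2, .inl ⟨rfl, rfl⟩⟩
    · exact ⟨A, (code_lt_imp _ _).1, B, (code_lt_neg B).trans (code_lt_imp _ _).2,
        .inr ⟨rfl, rfl⟩⟩

variable (Y : Sys)

theorem good_iff {N w : ℕ} (hw : w < 2 ^ N) : Good Y N w ↔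
    (∀ A, code A < N → code (neg A) < N → (bit w (neg A) ↔ ¬ bit w A)) ∧
    (∀ A, code A < N → ∀ B, code B < N →
      (code (and A B) < N → (bit w (and A B) ↔ bit w A ∧ bit w B)) ∧
      (code (or A B) < N → (bit w (or A B) ↔ bit w A ∨ bit w B)) ∧
      (code (imp A B) < N → IsB A B → bit w (imp A B)) ∧
      (bit w (imp A B) → (bit w A → bit w B) ∧ ¬ Y.diag A B)) ∧
    (∀ C, code C < N → ∀ D, code D < N → bit w (imp C D) →
      ∀ C', code C' < N → ∀ D', code D' < N →
      (code (imp C' D') < N → Y.tr C D C' D' → (bit w C' → bit w D') → bit w (imp C' D')) ∧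
      (bit w (imp C' D') → ¬ Y.conf C D C' D')) ∧
    (∀ C, code C < N → ∀ D, code D < N → bit w (imp C D) →
      ∀ A, code A < N → ∀ B, code B < N →
      ¬ Y.conf C D (imp A B) (neg (imp A (neg B))) ∧
      ¬ Y.conf C D (imp A (neg B)) (neg (imp A B))) := by
  have hi : ∀ {C D}, bit w (imp C D) → code C < N ∧ code D < N := fun h =>
    ⟨(code_lt_imp _ _).1.trans (code_lt_of_bit hw h), (code_lt_imp _ _).2.trans (code_lt_of_bit hw h)⟩
  constructor
  · intro h
    exact ⟨fun A _ => h.neg A, fun A _ B _ => ⟨h.and A B, h.or A B, fun h1 h2 => h.isB A B h2 h1,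
      fun h1 => ⟨h.impl A B h1, h.diag A B h1⟩⟩,
      fun C _ D _ h1 C' _ D' _ => ⟨fun h2 h3 => h.tr C D C' D' h3 h2 h1, h.conf C D C' D' h1⟩,
      fun C _ D _ h1 A _ B _ => ⟨h.confB _ _ _ _ h1 (.b1 A B), h.confB _ _ _ _ h1 (.b2 A B)⟩⟩
  · rintro ⟨h1, h2, h3, h4⟩
    constructor
    · exact fun A hA => h1 A ((code_lt_neg A).trans hA) hA
    · exact fun A B h => (h2 A ((code_lt_and A B).1.trans h) B ((code_lt_and A B).2.trans h)).1 h
    · exact fun A B h => (h2 A ((code_lt_or A B).1.trans h) B ((code_lt_or A B).2.trans h)).2.1 h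
    · exact fun C D h => ((h2 C (hi h).1 D (hi h).2).2.2.2 h).1
    · exact fun C D h h' =>
        (h2 C ((code_lt_imp C D).1.trans h') D ((code_lt_imp C D).2.trans h')).2.2.1 h' h
    · exact fun C D C' D' ht h h' => (h3 C (hi h').1 D (hi h').2 h' C'
        ((code_lt_imp C' D').1.trans h) D' ((code_lt_imp C' D').2.trans h)).1 h ht
    · exact fun C D C' D' h h' => (h3 C (hi h).1 D (hi h).2 h C' (hi h').1 D' (hi h').2).2 h'
    · rintro C D C' D' h (⟨A, B⟩ | ⟨A, B⟩) hc
      -- `conf_code` bounds the antecedent of a conflicting Boethius instance, which makes the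
      -- unbounded condition `confB` a finite check.
      · have h5 := (Y.conf_code hc).trans_lt (hi h).1
        exact (h4 C (hi h).1 D (hi h).2 h A ((code_lt_imp _ _).1.trans h5) B
          ((code_lt_imp _ _).2.trans h5)).1 hc
      · have h5 := (Y.conf_code hc).trans_lt (hi h).1
        exact (h4 C (hi h).1 D (hi h).2 h A ((code_lt_imp _ _).1.trans h5) B
          ((code_lt_neg B).trans ((code_lt_imp _ _).2.trans h5))).2 hc
    · exact fun C D h => ((h2 C (hi h).1 D (hi h).2).2.2.2 h).2

theorem primrec_good : PrimrecPred fun q : ℕ × ℕ => q.2 < 2 ^ q.1 ∧ Good Y q.1 q.2 := by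
  refine PrimrecPred.of_eq ?_ fun q => and_congr_right fun hq => (good_iff Y hq).symm
  repeat' first
    | with_reducible exact Primrec.fst
    | with_reducible exact Primrec.snd
    | with_reducible exact Primrec.id
    | with_reducible exact Primrec.const _
    | with_reducible refine primrec_forall ?_ ?_
    | with_reducible refine PrimrecPred.and ?_ ?_
    | with_reducible refine PrimrecPred.or ?_ ?_
    | with_reducible refine primrec_iff ?_ ?_
    | with_reducible refine PrimrecPred.not ?_
    | with_reducible refine primrec_imp ?_ ?_
    | with_reducible refine Primrec.nat_lt.comp ?_ ?_
    | with_reducible refine primrec_bit.comp ?_ ?_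
    | with_reducible refine primrec_code.comp ?_
    | with_reducible refine primrec_neg.comp ?_
    | with_reducible refine primrec_and.comp ?_ ?_
    | with_reducible refine primrec_or.comp ?_ ?_
    | with_reducible refine primrec_imp_form.comp ?_ ?_
    | with_reducible refine primrec_pow.comp ?_ ?_
    | with_reducible refine primrec_isB.comp ?_ ?_
    | with_reducible refine PrimrecPred.comp Y.diag_prim (.pair ?_ ?_)
    | with_reducible refine PrimrecPred.comp Y.tr_prim (.pair ?_ (.pair ?_ (.pair ?_ ?_)))
    | with_reducible refine PrimrecPred.comp Y.conf_prim (.pair ?_ (.pair ?_ (.pair ?_ ?_)))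
    | with_reducible refine Primrec.fst.comp ?_
    | with_reducible refine Primrec.snd.comp ?_

theorem coh_iff {N s : ℕ} : Coh Y N (bits N s) ↔ ∀ w < 2 ^ N, s.testBit w = true →
    (w < 2 ^ N ∧ Good Y N w) ∧ ∀ A, code A < N →
      (code (box A) < N → ¬ bit w (box A) →
        ∃ u < 2 ^ N, s.testBit u = true ∧ (w < 2 ^ N ∧ Acc N w u) ∧ ¬ bit u A) ∧
      (bit w (dia A) → ∃ u < 2 ^ N, s.testBit u = true ∧ (w < 2 ^ N ∧ Acc N w u) ∧ bit u A) := by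
  constructor
  · intro h w hw hs
    refine ⟨⟨hw, h.good w ⟨hw, hs⟩⟩, fun A _ => ⟨fun h1 h2 => ?_, fun h1 => ?_⟩⟩
    · obtain ⟨u, hu, h3, h4⟩ := h.box w ⟨hw, hs⟩ A h1 h2
      exact ⟨u, hu.1, hu.2, ⟨hw, h3⟩, h4⟩
    · obtain ⟨u, hu, h3, h4⟩ := h.dia w ⟨hw, hs⟩ A h1
      exact ⟨u, hu.1, hu.2, ⟨hw, h3⟩, h4⟩
  · intro h
    constructor
    · exact fun w hw => hw.1
    · exact fun w hw => (h w hw.1 hw.2).1.2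
    · intro w hw A h1 h2
      obtain ⟨u, h3, h4, h5, h6⟩ :=
        ((h w hw.1 hw.2).2 A ((code_lt_box A).trans h1)).1 h1 h2
      exact ⟨u, ⟨h3, h4⟩, h5.2, h6⟩
    · intro w hw A h1
      obtain ⟨u, h3, h4, h5, h6⟩ :=
        ((h w hw.1 hw.2).2 A ((code_lt_dia A).trans (code_lt_of_bit hw.1 h1))).2 h1
      exact ⟨u, ⟨h3, h4⟩, h5.2, h6⟩

theorem primrec_coh : PrimrecPred fun q : ℕ × ℕ => Coh Y q.1 (bits q.1 q.2) := by
  refine PrimrecPred.of_eq ?_ fun q => (coh_iff Y).symm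
  repeat' first
    | with_reducible exact Primrec.fst
    | with_reducible exact Primrec.snd
    | with_reducible exact Primrec.id
    | with_reducible exact Primrec.const _
    | with_reducible refine PrimrecPred.comp (primrec_good Y) (.pair ?_ ?_)
    | with_reducible refine PrimrecPred.comp primrec_acc (.pair ?_ (.pair ?_ ?_))
    | with_reducible refine primrec_forall ?_ ?_
    | with_reducible refine primrec_forall_lt ?_ ?_
    | with_reducible refine primrec_exists_lt ?_ ?_
    | with_reducible refine PrimrecPred.and ?_ ?_
    | with_reducible refine PrimrecPred.not ?_
    | with_reducible refine primrec_imp ?_ ?_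
    | with_reducible refine Primrec.nat_lt.comp ?_ ?_
    | with_reducible refine primrec_bit.comp ?_ ?_
    | with_reducible refine primrec_testBit.comp ?_ ?_
    | with_reducible refine primrec_code.comp ?_
    | with_reducible refine primrec_box.comp ?_
    | with_reducible refine primrec_dia.comp ?_
    | with_reducible refine primrec_pow.comp ?_ ?_
    | with_reducible refine Primrec.fst.comp ?_
    | with_reducible refine Primrec.snd.comp ?_

/-- The theorems of a system form a decidable set. -/
theorem Sys.computable : ComputablePred (MBCLTheorem Y.Ax) := by
  -- The split is classical: which case applies need not be decided, since each supplies an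
  -- algorithm.
  by_cases hY : ∀ C D C' D', IsB C D → IsB C' D' → ¬ Y.conf C D C' D'
  · have h : PrimrecPred fun A => ∀ s < 2 ^ 2 ^ (code A + 1),
        Coh Y (code A + 1) (bits (code A + 1) s) → ∀ w < 2 ^ (code A + 1),
          s.testBit w = true → bit w A := by
      repeat' first
        | with_reducible exact Primrec.fst
        | with_reducible exact Primrec.snd
        | with_reducible exact Primrec.id
        | with_reducible exact Primrec.const _
        | with_reducible refine PrimrecPred.comp (primrec_coh Y) (.pair ?_ ?_)
        | with_reducible refine primrec_forall_lt ?_ ?_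
        | with_reducible refine primrec_imp ?_ ?_
        | with_reducible refine Primrec.nat_lt.comp ?_ ?_
        | with_reducible refine primrec_bit.comp ?_ ?_
        | with_reducible refine primrec_testBit.comp ?_ ?_
        | with_reducible refine primrec_pow.comp ?_ ?_
        | with_reducible refine Primrec.nat_add.comp ?_ ?_
        | with_reducible refine primrec_code.comp ?_
        | with_reducible refine Primrec.fst.comp ?_
        | with_reducible refine Primrec.snd.comp ?_
      exact primrec_code
    exact h.computablePred.of_eq fun A => by
      simp only [thm_iff Y hY A, bits, Set.mem_ofPred_eq, and_imp]
  · push Not at hY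
    obtain ⟨C, D, C', D', h1, h2, h3⟩ := hY
    exact (PrimrecPred.of_eq (p := fun A : MForm => A = A) (Primrec.eq.comp .id .id)
      fun A => ⟨fun _ => thm_of_conf Y h1 h2 h3 A, fun _ => rfl⟩).computablePred

end MForm
end
end Connexive

/-! ### The basic calculus, where no moves exist and every path is constant -/

namespace Connexive
namespace MForm
open Relation

theorem Cl.impl {T : MForm → Prop} (hT : Cl T) (h : ∀ A, AxMBCL A → T A) {A B : MForm}
    (h1 : T (imp A B)) (h2 : T A) : T B :=
  (hT.mimp _ _).1 ((hT.mimp _ _).1 (h _ (.impl A B)) h1) h2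

theorem Cl.boethius {T : MForm → Prop} (hT : Cl T) (h : ∀ A, AxMBCL A → T A) {A B : MForm}
    (h1 : T (imp A B)) : ¬ T (imp A (MForm.neg B)) :=
  (hT.neg _).1 (hT.impl h (h _ (.b1 A B)) h1)

theorem Cl.aristotle {T : MForm → Prop} (hT : Cl T) (h : ∀ A, AxMBCL A → T A) {A B : MForm}
    (hAB : B = MForm.neg A ∨ A = MForm.neg B) : ¬ T (imp A B) := by
  rcases hAB with rfl | rfl
  · exact (hT.neg _).1 (h _ (.a1 A))
  · exact (hT.neg _).1 (h _ (.a2 B))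

/-- `Ax_MBCL` as a system. -/
def basicSys : Sys where
  Ax := AxMBCL
  tr _ _ _ _ := False
  conf C D C' D' := C = C' ∧ (D' = neg D ∨ D = neg D')
  diag C D := D = neg C ∨ C = neg D
  base _ h := h
  ax_iff T _ := ⟨fun h => ⟨h, fun _ _ _ _ h => h.elim⟩, fun h => h.1⟩
  tr_core h := h.elim
  tr_code h := h.elim
  conf_symm h := ⟨h.1.symm, h.2.symm⟩
  conf_code h := by rw [h.1]
  conf_sound T hT h C D C' D' hc h1 h2 := by
    obtain ⟨rfl, rfl | rfl⟩ := hc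
    · exact hT.boethius h h1 h2
    · exact hT.boethius h h2 h1
  diag_sound T hT h C D hd := hT.aristotle h hd
  conf_of_path {C D C' D' A B} h1 h2 := by
    rcases h1.cases_tail with h1 | ⟨_, _, h1⟩
    · rcases h2.cases_tail with h2 | ⟨_, _, h2⟩
      · simp only [Prod.mk.injEq] at h1 h2
        exact ⟨h1.1.symm.trans h2.1, .inl (by rw [← h2.2, h1.2])⟩
      · exact h2.elim
    · exact h1.elim
  diag_of_path {T C D A B} _ _ h hAB := by
    rcases h.cases_tail with h | ⟨_, _, h⟩
    · simp only [Prod.mk.injEq] at h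
      rw [← h.1, ← h.2]; exact hAB
    · exact h.1.elim
  tr_prim := (PrimrecPred.not (Primrec.eq.comp .id .id)).of_eq fun _ => by simp
  conf_prim := by
    repeat' first
      | with_reducible exact Primrec.fst
      | with_reducible exact Primrec.snd
      | with_reducible exact Primrec.id
      | with_reducible exact Primrec.const _
      | with_reducible refine PrimrecPred.and ?_ ?_
      | with_reducible refine PrimrecPred.or ?_ ?_
      | with_reducible refine Primrec.eq.comp ?_ ?_
      | with_reducible refine primrec_neg.comp ?_
      | with_reducible refine Primrec.fst.comp ?_
      | with_reducible refine Primrec.snd.comp ?_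
  diag_prim := by
    repeat' first
      | with_reducible exact Primrec.fst
      | with_reducible exact Primrec.snd
      | with_reducible exact Primrec.id
      | with_reducible exact Primrec.const _
      | with_reducible refine PrimrecPred.and ?_ ?_
      | with_reducible refine PrimrecPred.or ?_ ?_
      | with_reducible refine Primrec.eq.comp ?_ ?_
      | with_reducible refine primrec_neg.comp ?_
    
/-! ### Parity analysis on the grid of iterated negations -/

section
variable {G : ℕ → ℕ → Prop} {s t : ℕ → Prop} {k l d e : ℕ}

theorem alternating (hs : ∀ i, s (i + 1) ↔ ¬ s i) (i : ℕ) : s i ↔ (Even i ↔ s 0) := by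
  induction i with
  | zero => simp
  | succ i ih => rw [hs, ih, Nat.even_add_one]; tauto

/-- The truth values of the implications between the iterated negations of two formulas: `s`
and `t` are the truth values of the iterated negations. -/
structure Grid (G : ℕ → ℕ → Prop) (s t : ℕ → Prop) (k l d e : ℕ) : Prop where
  hs : ∀ i, s (i + 1) ↔ ¬ s i
  ht : ∀ j, t (j + 1) ↔ ¬ t j
  ok : ∀ {i j}, G i j → s i → t j
  one : ∀ {i j}, G i j → (s (i + 1) → t (j + 1)) → G (i + 1) (j + 1)
  two : ∀ {i j}, G i j → G (i + 2) (j + 2)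
  long : ∀ {i j}, k ≤ i → l ≤ j → G i j → (s (i + d) → t (j + e)) → G (i + d) (j + e)
  long2 : ∀ {i j}, k ≤ i → l ≤ j → G i j → G (i + 2 * d) (j + 2 * e)

namespace Grid
variable (h : Grid G s t k l d e)
include h

theorem up {i j : ℕ} (hG : G i j) (z : ℕ) : G (i + 2 * z) (j + 2 * z) := by
  induction z with
  | zero => exact hG
  | succ z ih => exact h.two ih

theorem s_add (i n : ℕ) : s (i + n) ↔ (Even n ↔ s i) := by
  rw [alternating h.hs (i + n), alternating h.hs i, Nat.even_add]; tauto

theorem t_add (i n : ℕ) : t (i + n) ↔ (Even n ↔ t i) := by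
  rw [alternating h.ht (i + n), alternating h.ht i, Nat.even_add]; tauto

/-- If `s i` holds, one diagonal step makes the antecedent false, and that step is vacuously
admissible. Double steps then pass `k` and `l` without changing truth values. -/
theorem normalize {i j : ℕ} (hG : G i j) :
    ∃ x, G (i + x) (j + x) ∧ ¬ s (i + x) ∧ k ≤ i + x ∧ l ≤ j + x := by
  by_cases hi : s i
  · have hj := h.ok hG hi
    have h1 : ¬ s (i + 1) := by rw [h.hs]; exact not_not.2 hi
    have h2 := h.up (h.one hG fun h' => (h1 h').elim) (k + l)
    refine ⟨1 + 2 * (k + l), ?_, ?_, by omega, by omega⟩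
    · rwa [← add_assoc, ← add_assoc]
    · rw [← add_assoc, h.s_add]; simpa using h1
  · refine ⟨2 * (k + l), h.up hG _, ?_, by omega, by omega⟩
    rw [h.s_add]; simpa using hi

/-- A long step from a false antecedent is blocked only if `d` is odd and `t (j + e)` fails; by `hc`
then `t j` fails too. A prior diagonal step makes both sides true, after which the odd shift `d`
makes the new antecedent false. -/
theorem step {i j : ℕ} (hk : k ≤ i) (hl : l ≤ j) (hG : G i j) (hi : ¬ s i)
    (hc : Even d ∨ Even e ∨ ¬ t j) : ∃ x, G (i + x + d) (j + x + e) := by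
  by_cases h1 : s (i + d) → t (j + e)
  · exact ⟨0, h.long hk hl hG h1⟩
  · rw [h.s_add, h.t_add] at h1
    have hd : ¬ Even d := by tauto
    have hj : ¬ t j := by tauto
    refine ⟨1, h.long (by omega) (by omega) (h.one hG fun _ => (h.ht j).2 hj) fun h2 => ?_⟩
    rw [h.s_add, h.hs] at h2
    tauto

theorem step2 {i j : ℕ} (hG : G i j) (z : ℕ) :
    ∃ x, G (i + x + 2 * z * d) (j + x + 2 * z * e) := by
  obtain ⟨x, h1, -, h2, h3⟩ := h.normalize hG
  refine ⟨x, ?_⟩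
  induction z with
  | zero => simpa using h1
  | succ z ih =>
    have := h.long2 (by omega) (by omega) ih
    convert this using 1 <;> ring

/-- When `d` and `e` are odd, diagonal and long steps flip both sides, so `s i ↔ t j` is preserved
and the next long step is again possible. -/
theorem steps (y : ℕ) : ∀ {i j : ℕ}, G i j → (Even d ∨ Even e ∨ (s i ↔ t j)) →
    ∃ x, G (i + x + y * d) (j + x + y * e) := by
  induction y with
  | zero => exact fun {i j} hG _ => ⟨0, by simpa using hG⟩
  | succ y ih =>
    intro i j hG hc
    obtain ⟨x, h1, h2, h3, h4⟩ := h.normalize hG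
    obtain ⟨x', h5⟩ := h.step h3 h4 h1 h2 (by
      rw [h.s_add] at h2; rw [h.t_add]; tauto)
    obtain ⟨x'', h6⟩ := ih h5 (by
      rw [add_assoc, add_assoc, add_assoc j, add_assoc j, h.s_add, h.t_add]
      simp only [Nat.even_add]; tauto)
    refine ⟨x + x' + x'', ?_⟩
    convert h6 using 1 <;> ring

theorem reach {i j y : ℕ} (hG : G i j) (hc : Even y ∨ Even d ∨ Even e ∨ (s i ↔ t j)) :
    ∃ x, G (i + x + y * d) (j + x + y * e) := by
  rcases hc with ⟨z, hz⟩ | hc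
  · obtain ⟨x, hx⟩ := h.step2 hG z
    exact ⟨x, by rwa [hz, ← two_mul]⟩
  · exact h.steps y hG hc

/-- The equation says that the two points, after their long steps, lie on adjacent diagonals.
Normalizing makes both antecedents false, hence their indices congruent mod 2, and double steps
bring them to the same antecedent, against `hB`. -/
theorem no_meet (hB : ∀ {i j}, G i j → ¬ G i (j + 1)) {i j i' j' y y' : ℕ} (hG : G i j)
    (hG' : G i' j') (hc : Even y ∨ Even d ∨ Even e ∨ (s i ↔ t j))
    (hc' : Even y' ∨ Even d ∨ Even e ∨ (s i' ↔ t j')) :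
    j + y * e + 1 + i' + y' * d ≠ j' + y' * e + i + y * d := by
  intro heq
  obtain ⟨x1, h1⟩ := h.reach hG hc
  obtain ⟨x2, h2, h2s, -⟩ := h.normalize h1
  obtain ⟨x3, h3⟩ := h.reach hG' hc'
  obtain ⟨x4, h4, h4s, -⟩ := h.normalize h3
  have hpar : Even (i + x1 + y * d + x2) ↔ Even (i' + x3 + y' * d + x4) := by
    rw [alternating h.hs] at h2s h4s
    tauto
  rw [Nat.even_iff, Nat.even_iff] at hpar
  rcases le_total (i + x1 + y * d + x2) (i' + x3 + y' * d + x4) with hle | hle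
  · obtain ⟨z, hz⟩ : ∃ z, i + x1 + y * d + x2 + 2 * z = i' + x3 + y' * d + x4 :=
      ⟨(i' + x3 + y' * d + x4 - (i + x1 + y * d + x2)) / 2, by omega⟩
    refine hB (h.up h2 z) ?_
    rw [hz]
    convert h4 using 1
    omega
  · obtain ⟨z, hz⟩ : ∃ z, i' + x3 + y' * d + x4 + 2 * z = i + x1 + y * d + x2 :=
      ⟨(i + x1 + y * d + x2 - (i' + x3 + y' * d + x4)) / 2, by omega⟩
    have h5 := h.up h4 z
    rw [hz] at h5
    refine hB h2 ?_
    convert h5 using 1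
    omega

/-- This removes the parity conditions of `no_meet`. For odd `d` and `e` the equation gives `i + j`
and `i' + j'` opposite parities, so one point has sides of equal truth value and allows any number
of long steps. The other needs an even number. -/
theorem no_conf (hB : ∀ {i j}, G i j → ¬ G i (j + 1)) {i j i' j' y y' : ℕ} (hG : G i j)
    (hG' : G i' j') : j + y * e + 1 + i' + y' * d ≠ j' + y' * e + i + y * d := by
  intro heq
  by_cases hde : Even d ∨ Even e
  · exact h.no_meet hB hG hG' (by tauto) (by tauto) heq
  -- Adding one long step on both sides preserves the equation and changes the parity of `y` and
  -- `y'`.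
  have heq' : j + (y + 1) * e + 1 + i' + (y' + 1) * d = j' + (y' + 1) * e + i + (y + 1) * d := by
    simp only [add_mul]; omega
  have hde' : ¬ Even d ∧ ¬ Even e := not_or.1 hde
  have cls : ∀ i j, (s i ↔ t j) ↔ (Even (i + j) ↔ (s 0 ↔ t 0)) := fun i j => by
    rw [alternating h.hs i, alternating h.ht j, Nat.even_add]; tauto
  have hp : Even (i + j) ↔ ¬ Even (i' + j') := by
    have h1 : Even (y * d + y * e) := by simp [Nat.even_add, Nat.even_mul, hde']
    have h2 : Even (y' * d + y' * e) := by simp [Nat.even_add, Nat.even_mul, hde']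
    simp only [Nat.even_iff] at h1 h2 ⊢
    omega
  by_cases hst : s i ↔ t j
  · by_cases hy : Even y'
    · exact h.no_meet hB hG hG' (.inr (.inr (.inr hst))) (.inl hy) heq
    · exact h.no_meet hB hG hG' (.inr (.inr (.inr hst))) (.inl (Nat.even_add_one.2 hy)) heq'
  · have hst' : s i' ↔ t j' := by
      rw [cls] at hst ⊢; tauto
    by_cases hy : Even y
    · exact h.no_meet hB hG hG' (.inl hy) (.inr (.inr (.inr hst'))) heq
    · exact h.no_meet hB hG hG' (.inl (Nat.even_add_one.2 hy)) (.inr (.inr (.inr hst'))) heq'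

end Grid
end

end MForm
end Connexive

/-! ### The systems GCUN -/

namespace Connexive
namespace MForm
open Relation

/-- The pairs `(¬ᵖA, ¬^q B)` and `(¬ʳA, ¬ᵘB)`. -/
def Shift (p q r u : ℕ) (C D C' D' : MForm) : Prop :=
  ∃ A B, C = negs p A ∧ D = negs q B ∧ C' = negs r A ∧ D' = negs u B

/-- The closure conditions of the systems GCUN. -/
def gcunTr (k l m n : ℕ) (C D C' D' : MForm) : Prop :=
  Shift 0 0 1 1 C D C' D' ∨ Shift 0 0 2 2 C D C' D' ∨ Shift k l m n C D C' D' ∨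
    Shift k l (2 * m - k) (2 * n - l) C D C' D'

/-- The implications `C → D` and `C' → D'` lead to `A → B` and `A → ¬B` for some `A`, `B`. -/
def gcunMeet (d e : ℕ) (C D C' D' : MForm) : Prop :=
  ∃ A B i j i' j', C = negs i A ∧ D = negs j B ∧ C' = negs i' A ∧ D' = negs j' B ∧
    ∃ y y', j + y * e + 1 + i' + y' * d = j' + y' * e + i + y * d

/-- The implication `C → D` leads to `A → ¬A` or to `¬A → A` for some `A`. -/
def gcunDiag (d e : ℕ) (C D : MForm) : Prop :=
  ∃ A i j, C = negs i A ∧ D = negs j A ∧ ∃ y, (Even y ∨ Even d ∨ Even e) ∧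
    (j + y * e = i + y * d + 1 ∨ j + y * e + 1 = i + y * d)

theorem code_le_negs (i : ℕ) (A : MForm) : code A + i ≤ code (negs i A) := by
  induction i with
  | zero => exact le_rfl
  | succ i ih => have := code_lt_neg (negs i A); rw [negs]; omega

theorem code_negs_mono {i j : ℕ} (h : i ≤ j) (A : MForm) : code (negs i A) ≤ code (negs j A) := by
  obtain ⟨c, rfl⟩ := Nat.exists_eq_add_of_le' h
  rw [← negs_negs]
  exact (Nat.le_add_right _ _).trans (code_le_negs c _)

theorem primrec_shift (p q r u : ℕ) : PrimrecPred fun x : MForm × MForm × MForm × MForm =>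
    Shift p q r u x.1 x.2.1 x.2.2.1 x.2.2.2 := by
  have h : PrimrecPred fun x : MForm × MForm × MForm × MForm =>
      ∃ A, code A < code x.1 + 1 ∧ ∃ B, code B < code x.2.1 + 1 ∧
        (x.1 = negs p A ∧ x.2.1 = negs q B ∧ x.2.2.1 = negs r A ∧ x.2.2.2 = negs u B) := by
    repeat' first
      | with_reducible exact Primrec.fst
      | with_reducible exact Primrec.snd
      | with_reducible exact Primrec.id
      | with_reducible exact Primrec.const _
      | with_reducible refine primrec_exists ?_ ?_
      | with_reducible refine PrimrecPred.and ?_ ?_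
      | with_reducible refine Primrec.nat_lt.comp ?_ ?_
      | with_reducible refine Primrec.eq.comp ?_ ?_
      | with_reducible refine primrec_code.comp ?_
      | with_reducible refine primrec_negs.comp ?_ ?_
      | with_reducible refine Primrec.nat_add.comp ?_ ?_
      | with_reducible refine Primrec.fst.comp ?_
      | with_reducible refine Primrec.snd.comp ?_
  refine h.of_eq fun x => ⟨?_, ?_⟩
  · rintro ⟨A, -, B, -, h⟩
    exact ⟨A, B, h⟩
  · rintro ⟨A, B, h⟩
    have h1 := code_le_negs p A
    have h2 := code_le_negs q B
    refine ⟨A, ?_, B, ?_, h⟩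
    · rw [h.1]; omega
    · rw [h.2.1]; omega

/-- Only the difference of `y` and `y'` matters, so one of them may be taken as `0`. If `d = e` both
may; otherwise `d` and `e` differ by at least 1, which bounds the other. -/
theorem meet_bound {d e i j i' j' : ℕ}
    (h : ∃ y y', j + y * e + 1 + i' + y' * d = j' + y' * e + i + y * d) :
    ∃ y < i + j + i' + j' + 2, ∃ y' < i + j + i' + j' + 2,
      j + y * e + 1 + i' + y' * d = j' + y' * e + i + y * d := by
  obtain ⟨y, y', h⟩ := h
  have aux : ∀ a b c z f : ℕ, z * (c + f + 1) + a = z * c + b → z ≤ b := by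
    intro a b c z f h
    have h1 : z * (c + f + 1) = z * c + z * f + z := by ring
    omega
  rcases le_total y y' with hy | hy
  · obtain ⟨z, rfl⟩ := Nat.exists_eq_add_of_le hy
    have h' : j + 0 * e + 1 + i' + z * d = j' + z * e + i + 0 * d := by
      simp only [add_mul] at h; omega
    rcases lt_trichotomy d e with hde | rfl | hde
    · obtain ⟨f, rfl⟩ := Nat.exists_eq_add_of_lt hde
      refine ⟨0, by omega, z, ?_, h'⟩
      have := aux (j' + i) (j + 1 + i') d z f (by omega)
      omega
    · exact ⟨0, by omega, 0, by omega, by omega⟩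
    · obtain ⟨f, rfl⟩ := Nat.exists_eq_add_of_lt hde
      refine ⟨0, by omega, z, ?_, h'⟩
      have := aux (j + 1 + i') (j' + i) e z f (by omega)
      omega
  · obtain ⟨z, rfl⟩ := Nat.exists_eq_add_of_le hy
    have h' : j + z * e + 1 + i' + 0 * d = j' + 0 * e + i + z * d := by
      simp only [add_mul] at h; omega
    rcases lt_trichotomy d e with hde | rfl | hde
    · obtain ⟨f, rfl⟩ := Nat.exists_eq_add_of_lt hde
      refine ⟨z, ?_, 0, by omega, h'⟩
      have := aux (j + 1 + i') (j' + i) d z f (by omega)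
      omega
    · exact ⟨0, by omega, 0, by omega, by omega⟩
    · obtain ⟨f, rfl⟩ := Nat.exists_eq_add_of_lt hde
      refine ⟨z, ?_, 0, by omega, h'⟩
      have := aux (j' + i) (j + 1 + i') e z f (by omega)
      omega

/-- For `d ≠ e` the equation itself bounds `y`, so its parity need not change; for `d = e` the value
`0` works and is even. -/
theorem diag_bound {d e i j : ℕ} (h : ∃ y, (Even y ∨ Even d ∨ Even e) ∧
      (j + y * e = i + y * d + 1 ∨ j + y * e + 1 = i + y * d)) :
    ∃ y < i + j + 2, (y % 2 = 0 ∨ Even d ∨ Even e) ∧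
      (j + y * e = i + y * d + 1 ∨ j + y * e + 1 = i + y * d) := by
  obtain ⟨y, hc, h⟩ := h
  rw [Nat.even_iff (n := y)] at hc
  rcases lt_trichotomy d e with hde | rfl | hde
  · obtain ⟨f, rfl⟩ := Nat.exists_eq_add_of_lt hde
    have h1 : y * (d + f + 1) = y * d + y * f + y := by ring
    exact ⟨y, by omega, hc, h⟩
  · exact ⟨0, by omega, .inl rfl, by omega⟩
  · obtain ⟨f, rfl⟩ := Nat.exists_eq_add_of_lt hde
    have h1 : y * (e + f + 1) = y * e + y * f + y := by ring
    exact ⟨y, by omega, hc, h⟩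

theorem primrec_meet (d e : ℕ) : PrimrecPred fun x : MForm × MForm × MForm × MForm =>
    gcunMeet d e x.1 x.2.1 x.2.2.1 x.2.2.2 := by
  have h : PrimrecPred fun x : MForm × MForm × MForm × MForm =>
      ∃ A, code A < code x.1 + 1 ∧ ∃ B, code B < code x.2.1 + 1 ∧
        ∃ i < code x.1 + 1, ∃ j < code x.2.1 + 1, ∃ i' < code x.2.2.1 + 1,
        ∃ j' < code x.2.2.2 + 1,
        (x.1 = negs i A ∧ x.2.1 = negs j B ∧ x.2.2.1 = negs i' A ∧ x.2.2.2 = negs j' B ∧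
          ∃ y < i + j + i' + j' + 2, ∃ y' < i + j + i' + j' + 2,
            j + y * e + 1 + i' + y' * d = j' + y' * e + i + y * d) := by
    repeat' first
      | with_reducible exact Primrec.fst
      | with_reducible exact Primrec.snd
      | with_reducible exact Primrec.id
      | with_reducible exact Primrec.const _
      | with_reducible refine primrec_exists ?_ ?_
      | with_reducible refine primrec_exists_lt ?_ ?_
      | with_reducible refine PrimrecPred.and ?_ ?_
      | with_reducible refine Primrec.nat_lt.comp ?_ ?_
      | with_reducible refine Primrec.eq.comp ?_ ?_
      | with_reducible refine primrec_code.comp ?_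
      | with_reducible refine primrec_negs.comp ?_ ?_
      | with_reducible refine Primrec.nat_add.comp ?_ ?_
      | with_reducible refine Primrec.nat_mul.comp ?_ ?_
      | with_reducible refine Primrec.fst.comp ?_
      | with_reducible refine Primrec.snd.comp ?_
  refine h.of_eq fun x => ⟨?_, ?_⟩
  · rintro ⟨A, -, B, -, i, -, j, -, i', -, j', -, h1, h2, h3, h4, y, -, y', -, h⟩
    exact ⟨A, B, i, j, i', j', h1, h2, h3, h4, y, y', h⟩
  · rintro ⟨A, B, i, j, i', j', h1, h2, h3, h4, h⟩
    have e1 := code_le_negs i A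
    have e2 := code_le_negs j B
    have e3 := code_le_negs i' A
    have e4 := code_le_negs j' B
    rw [← h1] at e1
    rw [← h2] at e2
    rw [← h3] at e3
    rw [← h4] at e4
    exact ⟨A, by omega, B, by omega, i, by omega, j, by omega, i', by omega, j', by omega,
      h1, h2, h3, h4, meet_bound h⟩

theorem primrec_diag (d e : ℕ) : PrimrecPred fun x : MForm × MForm =>
    gcunDiag d e x.1 x.2 := by
  have hde : PrimrecPred fun _ : ((((MForm × MForm) × MForm) × ℕ) × ℕ) × ℕ => Even d ∨ Even e := by
    by_cases h : Even d ∨ Even e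
    · exact (Primrec.eq.comp (.const 0) (.const 0)).of_eq fun _ => by simp [h]
    · exact (Primrec.eq.comp (.const 0) (.const 1)).of_eq fun _ => by simp [h]
  have h : PrimrecPred fun x : MForm × MForm =>
      ∃ A, code A < code x.1 + 1 ∧ ∃ i < code x.1 + 1, ∃ j < code x.2 + 1,
        (x.1 = negs i A ∧ x.2 = negs j A ∧ ∃ y < i + j + 2, (y % 2 = 0 ∨ Even d ∨ Even e) ∧
          (j + y * e = i + y * d + 1 ∨ j + y * e + 1 = i + y * d)) := by
    repeat' first
      | exact hde
      | with_reducible exact Primrec.fst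
      | with_reducible exact Primrec.snd
      | with_reducible exact Primrec.id
      | with_reducible exact Primrec.const _
      | with_reducible refine primrec_exists ?_ ?_
      | with_reducible refine primrec_exists_lt ?_ ?_
      | with_reducible refine PrimrecPred.and ?_ ?_
      | with_reducible refine PrimrecPred.or ?_ ?_
      | with_reducible refine Primrec.nat_lt.comp ?_ ?_
      | with_reducible refine Primrec.eq.comp ?_ ?_
      | with_reducible refine primrec_code.comp ?_
      | with_reducible refine primrec_negs.comp ?_ ?_
      | with_reducible refine Primrec.nat_add.comp ?_ ?_
      | with_reducible refine Primrec.nat_mul.comp ?_ ?_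
      | with_reducible refine Primrec.nat_mod.comp ?_ ?_
      | with_reducible refine Primrec.fst.comp ?_
      | with_reducible refine Primrec.snd.comp ?_
  refine h.of_eq fun x => ⟨?_, ?_⟩
  · rintro ⟨A, -, i, -, j, -, h1, h2, y, -, h3, h4⟩
    rw [← Nat.even_iff] at h3
    exact ⟨A, i, j, h1, h2, y, h3, h4⟩
  · rintro ⟨A, i, j, h1, h2, h⟩
    have e1 := code_le_negs i A
    have e2 := code_le_negs j A
    rw [← h1] at e1
    rw [← h2] at e2
    exact ⟨A, by omega, i, by omega, j, by omega, h1, h2, diag_bound h⟩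

section
variable {k l m n : ℕ}

theorem iff_iff_not_iff {a b c : Prop} (h : ¬ (a ↔ b)) : (a ↔ c) ↔ ¬ (b ↔ c) := by tauto

theorem iff_of_shift_iff {a b p q r : Prop} (h : ((a ↔ r) ↔ p) ↔ ((b ↔ r) ↔ q)) :
    (a ↔ p) ↔ (b ↔ q) := by
  by_cases hr : r
  · simpa only [hr, iff_true] using h
  · simp only [hr, iff_false] at h
    tauto

theorem gcunTr.spec (hkm : k ≤ m) (hln : l ≤ n) {C D C' D' : MForm}
    (h : gcunTr k l m n C D C' D') : core C' = core C ∧ core D' = core D ∧ ∃ x y,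
      deg C' = deg C + x + y * (m - k) ∧ deg D' = deg D + x + y * (n - l) := by
  rcases h with ⟨A, B, rfl, rfl, rfl, rfl⟩ | ⟨A, B, rfl, rfl, rfl, rfl⟩ |
    ⟨A, B, rfl, rfl, rfl, rfl⟩ | ⟨A, B, rfl, rfl, rfl, rfl⟩ <;>
    simp only [core_negs, deg_negs, true_and]
  · exact ⟨1, 0, by omega, by omega⟩
  · exact ⟨2, 0, by omega, by omega⟩
  · exact ⟨0, 1, by omega, by omega⟩
  · exact ⟨0, 2, by omega, by omega⟩

theorem gcunTr.code_le (hkm : k ≤ m) (hln : l ≤ n) {C D C' D' : MForm}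
    (h : gcunTr k l m n C D C' D') : code C ≤ code C' ∧ code D ≤ code D' := by
  rcases h with ⟨A, B, h1, h2, h3, h4⟩ | ⟨A, B, h1, h2, h3, h4⟩ |
    ⟨A, B, h1, h2, h3, h4⟩ | ⟨A, B, h1, h2, h3, h4⟩ <;>
    rw [h1, h2, h3, h4] <;> exact ⟨code_negs_mono (by omega) _, code_negs_mono (by omega) _⟩

theorem gcun_path (hkm : k ≤ m) (hln : l ≤ n) {P Q : MForm × MForm}
    (h : ReflTransGen (fun P Q : MForm × MForm => gcunTr k l m n P.1 P.2 Q.1 Q.2) P Q) :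
    core Q.1 = core P.1 ∧ core Q.2 = core P.2 ∧ ∃ x y,
      deg Q.1 = deg P.1 + x + y * (m - k) ∧ deg Q.2 = deg P.2 + x + y * (n - l) := by
  induction h with
  | refl => exact ⟨rfl, rfl, 0, 0, by simp, by simp⟩
  | tail _ h ih =>
    obtain ⟨h1, h2, x, y, h3, h4⟩ := h.spec hkm hln
    obtain ⟨h1', h2', x', y', h3', h4'⟩ := ih
    refine ⟨h1.trans h1', h2.trans h2', x + x', y + y', ?_, ?_⟩
    · rw [h3, h3']; ring
    · rw [h4, h4']; ring

theorem meet_of_path (hkm : k ≤ m) (hln : l ≤ n) {C D C' D' A B : MForm}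
    (h1 : ReflTransGen (fun P Q : MForm × MForm => gcunTr k l m n P.1 P.2 Q.1 Q.2)
      (C, D) (A, B))
    (h2 : ReflTransGen (fun P Q : MForm × MForm => gcunTr k l m n P.1 P.2 Q.1 Q.2)
      (C', D') (A, neg B)) : gcunMeet (m - k) (n - l) C D C' D' := by
  obtain ⟨c1, c2, x, y, d1, d2⟩ := gcun_path hkm hln h1
  obtain ⟨c1', c2', x', y', d1', d2'⟩ := gcun_path hkm hln h2
  simp only [core, deg] at c1 c2 d1 d2 c1' c2' d1' d2'
  refine ⟨core A, core B, deg C, deg D, deg C', deg D', ?_, ?_, ?_, ?_, y, y', by omega⟩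
  · rw [c1, negs_deg_core]
  · rw [c2, negs_deg_core]
  · rw [c1', negs_deg_core]
  · rw [c2', negs_deg_core]

theorem Cl.even_deg {T : MForm → Prop} (hT : Cl T) (A : MForm) :
    T A ↔ (Even (deg A) ↔ T (MForm.core A)) := by
  rw [hT.core A, par_iff]

/-- Along a path of true conditions, the number of long steps is even unless the parities of
the shifts or the truth values allow otherwise. -/
theorem gcun_ok_path (hkm : k ≤ m) (hln : l ≤ n) {T : MForm → Prop} (hT : Cl T)
    {P Q : MForm × MForm} (hP : T P.1 → T P.2)
    (h : ReflTransGen (fun P Q : MForm × MForm => gcunTr k l m n P.1 P.2 Q.1 Q.2 ∧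
      (T Q.1 → T Q.2)) P Q) :
    (T Q.1 → T Q.2) ∧ core Q.1 = core P.1 ∧ core Q.2 = core P.2 ∧ ∃ x y,
      deg Q.1 = deg P.1 + x + y * (m - k) ∧ deg Q.2 = deg P.2 + x + y * (n - l) ∧
      (Even y ∨ Even (m - k) ∨ Even (n - l) ∨ (T P.1 ↔ T P.2)) := by
  induction h with
  | refl => exact ⟨hP, rfl, rfl, 0, 0, by simp, by simp, .inl Even.zero⟩
  | @tail Q Q' _ h ih =>
    obtain ⟨h, hQ'⟩ := h
    obtain ⟨hQ, h1, h2, x, y, h3, h4, h5⟩ := ih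
    obtain ⟨c1, c2, -⟩ := h.spec hkm hln
    refine ⟨hQ', c1.trans h1, c2.trans h2, ?_⟩
    obtain ⟨Q1, Q2⟩ := Q
    obtain ⟨Q1', Q2'⟩ := Q'
    simp only at *
    rcases h with ⟨A, B, rfl, rfl, rfl, rfl⟩ | ⟨A, B, rfl, rfl, rfl, rfl⟩ |
      ⟨A, B, rfl, rfl, rfl, rfl⟩ | ⟨A, B, rfl, rfl, rfl, rfl⟩ <;>
      simp only [deg_negs] at *
    · exact ⟨x + 1, y, by omega, by omega, h5⟩
    · exact ⟨x + 2, y, by omega, by omega, h5⟩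
    · refine ⟨x, y + 1, by rw [add_mul]; omega, by rw [add_mul]; omega, ?_⟩
      by_cases hd : Even (m - k)
      · exact .inr (.inl hd)
      by_cases he : Even (n - l)
      · exact .inr (.inr (.inl he))
      refine .inr (.inr (.inr ?_))
      -- For odd `m - k` and `n - l` the long move flips both sides, so the conditions before and
      -- after it together force equal truth values.
      have hA : T (negs m A) ↔ ¬ T (negs k A) := by
        rw [hT.negs, hT.negs, par_iff, par_iff]
        rw [Nat.even_sub hkm] at hd
        exact iff_iff_not_iff hd
      have hB : T (negs n B) ↔ ¬ T (negs l B) := by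
        rw [hT.negs, hT.negs, par_iff, par_iff]
        rw [Nat.even_sub hln] at he
        exact iff_iff_not_iff he
      have hAB : T (negs k A) ↔ T (negs l B) := by
        rw [hA, hB] at hQ'
        exact ⟨hQ, fun h => by_contra fun h' => hQ' h' h⟩
      rw [hT.even_deg, hT.even_deg (negs l B), h1, h2, deg_negs, deg_negs, h3, h4] at hAB
      rw [hT.even_deg P.1, hT.even_deg P.2]
      -- The shifts so far have equal parity on both sides, so equality of truth values passes back
      -- to the start of the path.
      have hxy : Even (x + y * (m - k)) ↔ Even (x + y * (n - l)) := by
        simp only [Nat.even_add, Nat.even_mul, hd, he]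
      rw [add_assoc, add_assoc, Nat.even_add, Nat.even_add (m := deg P.2), hxy] at hAB
      exact iff_of_shift_iff hAB
    · refine ⟨x, y + 2, by rw [add_mul]; omega, by rw [add_mul]; omega, ?_⟩
      rcases h5 with h5 | h5
      · exact .inl (h5.add even_two)
      · exact .inr h5

/-- An odd number of odd long moves requires `C` and `D` to have equal truth values. Their cores
coincide, so their degrees would be congruent mod 2, whereas reaching `A → ¬A` or `¬A → A` forces
them to differ mod 2. -/
theorem gcunDiag_of_path (hkm : k ≤ m) (hln : l ≤ n) {T : MForm → Prop} (hT : Cl T)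
    {C D A B : MForm} (hC : T C → T D)
    (h : ReflTransGen (fun P Q : MForm × MForm => gcunTr k l m n P.1 P.2 Q.1 Q.2 ∧
      (T Q.1 → T Q.2)) (C, D) (A, B)) (hAB : B = neg A ∨ A = neg B) :
    gcunDiag (m - k) (n - l) C D := by
  obtain ⟨-, c1, c2, x, y, d1, d2, hp⟩ := gcun_ok_path hkm hln hT hC h
  simp only at c1 c2 d1 d2 hp
  have hc : core A = core B := by rcases hAB with rfl | rfl <;> rfl
  have hd : deg B = deg A + 1 ∨ deg A = deg B + 1 := by
    rcases hAB with rfl | rfl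
    · exact .inl rfl
    · exact .inr rfl
  have hCD : core D = core C := by rw [← c1, ← c2, hc]
  refine ⟨core C, deg C, deg D, (negs_deg_core C).symm, by rw [← hCD, negs_deg_core], y, ?_,
    by omega⟩
  by_contra hcon
  simp only [not_or] at hcon
  have hp' : T C ↔ T D := by tauto
  rw [hT.even_deg C, hT.even_deg D, hCD] at hp'
  have e1 : Even (y * (m - k) + y * (n - l)) := by simp [Nat.even_add, Nat.even_mul, hcon]
  have e2 : Even (deg C) ↔ Even (deg D) := by tauto
  simp only [Nat.even_iff] at e1 e2
  omega

theorem gcun_grid (hkm : k ≤ m) (hln : l ≤ n) {T : MForm → Prop} (hT : Cl T)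
    (hax : ∀ A, AxMBCL A → T A)
    (htr : ∀ C D C' D', gcunTr k l m n C D C' D' → T (imp C D) → (T C' → T D') → T (imp C' D'))
    (A B : MForm) : Grid (fun i j => T (imp (negs i A) (negs j B))) (fun i => T (negs i A))
      (fun j => T (negs j B)) k l (m - k) (n - l) where
  hs i := hT.neg _
  ht j := hT.neg _
  ok h1 h2 := hT.impl hax h1 h2
  one h1 h2 := htr _ _ _ _ (.inl ⟨_, _, rfl, rfl, rfl, rfl⟩) h1 h2
  two {i j} h1 := by
    refine htr _ _ _ _ (.inr (.inl ⟨negs i A, negs j B, rfl, rfl, rfl, rfl⟩)) h1 fun h2 => ?_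
    simp only [negs, hT.neg, not_not] at h2 ⊢
    exact hT.impl hax h1 h2
  long {i j} hi hj h1 h2 := by
    obtain ⟨i, rfl⟩ := Nat.exists_eq_add_of_le hi
    obtain ⟨j, rfl⟩ := Nat.exists_eq_add_of_le hj
    refine htr _ _ _ _ (.inr (.inr (.inl ⟨negs i A, negs j B, ?_, ?_, ?_, ?_⟩))) h1 h2 <;>
      rw [negs_negs] <;> congr 1 <;> omega
  long2 {i j} hi hj h1 := by
    obtain ⟨i, rfl⟩ := Nat.exists_eq_add_of_le hi
    obtain ⟨j, rfl⟩ := Nat.exists_eq_add_of_le hj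
    refine htr _ _ _ _ (.inr (.inr (.inr ⟨negs i A, negs j B, ?_, ?_, ?_, ?_⟩))) h1 ?_
    · rw [negs_negs]
    · rw [negs_negs]
    · rw [negs_negs]; congr 1; omega
    · rw [negs_negs]; congr 1; omega
    · intro h2
      have h3 := hT.impl hax h1
      rw [hT.negs, par_iff] at h2 h3 ⊢
      rw [hT.negs, par_iff] at h3
      -- An even number of added negations leaves both truth values unchanged, so the side condition
      -- follows from the implication already true.
      simp only [Nat.even_add, even_two_mul, iff_true] at h2 h3 ⊢
      exact h3 h2

/-- Classically, a disjunct such as `¬A ∧ B` is the failure of `¬A ⊃ ¬B`, so the axiom is a move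
with a side condition. The axioms with doubled shifts have none, because theirs holds automatically.
-/
theorem gcun_ax_iff (hkm : k ≤ m) (hln : l ≤ n) {T : MForm → Prop} (hT : Cl T) :
    (∀ A, AxMBCLGCUN k l m n A → T A) ↔ (∀ A, AxMBCL A → T A) ∧
      ∀ C D C' D', gcunTr k l m n C D C' D' → T (imp C D) → (T C' → T D') → T (imp C' D') := by
  constructor
  · intro h
    refine ⟨fun A hA => h A (.base hA), ?_⟩
    rintro C D C' D' (⟨A, B, rfl, rfl, rfl, rfl⟩ | ⟨A, B, rfl, rfl, rfl, rfl⟩ |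
      ⟨A, B, rfl, rfl, rfl, rfl⟩ | ⟨A, B, rfl, rfl, rfl, rfl⟩) h1 h2
    · have h3 := (hT.mimp _ _).1 (h _ (.cun1 C D)) h1
      rw [hT.or, hT.and] at h3
      refine h3.resolve_right fun h4 => ?_
      exact (hT.neg D).1 (h2 h4.1) h4.2
    · exact (hT.mimp _ _).1 (h _ (.cun2 C D)) h1
    · have h3 := (hT.mimp _ _).1 (h _ (.gcun1 A B)) h1
      rw [hT.or, hT.and] at h3
      refine h3.resolve_right fun h4 => ?_
      exact (hT.neg _).1 h4.2 (h2 h4.1)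
    · exact (hT.mimp _ _).1 (h _ (.gcun2 A B)) h1
  · rintro ⟨hax, htr⟩ A hA
    cases hA with
    | base hA => exact hax A hA
    | cun1 A B =>
      refine (hT.mimp _ _).2 fun h1 => ?_
      rw [hT.or, hT.and]
      have h2 := htr _ _ _ _ (.inl ⟨A, B, rfl, rfl, rfl, rfl⟩) h1
      simp only [negs, hT.neg] at h2 ⊢
      tauto
    | cun2 A B =>
      exact (hT.mimp _ _).2 fun h1 => (gcun_grid hkm hln hT hax htr A B).two (i := 0) (j := 0) h1
    | gcun1 A B =>
      refine (hT.mimp _ _).2 fun h1 => ?_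
      rw [hT.or, hT.and]
      have h2 := htr _ _ _ _ (.inr (.inr (.inl ⟨A, B, rfl, rfl, rfl, rfl⟩))) h1
      rw [negs, hT.neg]
      tauto
    | gcun2 A B =>
      refine (hT.mimp _ _).2 fun h1 => ?_
      have h2 := (gcun_grid hkm hln hT hax htr A B).long2 le_rfl le_rfl h1
      convert h2 using 3 <;> omega

/-- `Ax_MBCL^GCUN` as a system. -/
def gcunSys (hkm : k ≤ m) (hln : l ≤ n) : Sys where
  Ax := AxMBCLGCUN k l m n
  tr := gcunTr k l m n
  -- `gcunMeet` gives the extra negation to the second implication, hence the symmetrization.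
  conf C D C' D' := gcunMeet (m - k) (n - l) C D C' D' ∨ gcunMeet (m - k) (n - l) C' D' C D
  diag := gcunDiag (m - k) (n - l)
  base _ h := .base h
  ax_iff _ hT := gcun_ax_iff hkm hln hT
  tr_core h := ⟨(h.spec hkm hln).1, (h.spec hkm hln).2.1⟩
  tr_code h := h.code_le hkm hln
  conf_symm h := h.symm
  conf_code {C D A B D'} h := by
    have hc : core C = imp A B := by
      rcases h with ⟨A', B', i, j, i', j', h1, -, h3, -⟩ | ⟨A', B', i, j, i', j', h3, -, h1, -⟩
      · rw [h1, core_negs, ← core_negs i' A', ← h3]; rfl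
      · rw [h1, core_negs, ← core_negs i A', ← h3]; rfl
    rw [← hc]
    have := code_le_negs (deg C) (core C)
    rw [negs_deg_core] at this
    omega
  conf_sound T hT h C D C' D' hc h1 h2 := by
    obtain ⟨hax, htr⟩ := (gcun_ax_iff hkm hln hT).1 h
    rcases hc with ⟨A, B, i, j, i', j', rfl, rfl, rfl, rfl, y, y', hy⟩ |
      ⟨A, B, i', j', i, j, rfl, rfl, rfl, rfl, y, y', hy⟩
    · exact (gcun_grid hkm hln hT hax htr A B).no_conf (fun h => hT.boethius hax h) h1 h2 hy
    · exact (gcun_grid hkm hln hT hax htr A B).no_conf (fun h => hT.boethius hax h) h2 h1 hy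
  diag_sound T hT h C D hd h1 := by
    obtain ⟨hax, htr⟩ := (gcun_ax_iff hkm hln hT).1 h
    obtain ⟨A, i, j, rfl, rfl, y, hy, he⟩ := hd
    obtain ⟨x, hx⟩ := (gcun_grid hkm hln hT hax htr A A).reach (y := y) h1 (by tauto)
    rcases he with he | he
    · refine hT.aristotle hax (.inl ?_) hx
      rw [show j + x + y * (n - l) = i + x + y * (m - k) + 1 by omega]; rfl
    · refine hT.aristotle hax (.inr ?_) hx
      rw [show i + x + y * (m - k) = j + x + y * (n - l) + 1 by omega]; rfl
  conf_of_path h1 h2 := .inl (meet_of_path hkm hln h1 h2)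
  diag_of_path hT hC h hAB := gcunDiag_of_path hkm hln hT hC h hAB
  tr_prim := (primrec_shift _ _ _ _).or ((primrec_shift _ _ _ _).or
    ((primrec_shift _ _ _ _).or (primrec_shift _ _ _ _)))
  conf_prim := (primrec_meet _ _).or ((primrec_meet (m - k) (n - l)).comp
    (f := fun x : MForm × MForm × MForm × MForm => (x.2.2.1, x.2.2.2, x.1, x.2.1))
    ((Primrec.fst.comp (Primrec.snd.comp .snd)).pair ((Primrec.snd.comp (Primrec.snd.comp .snd)).pair
      (Primrec.fst.pair (Primrec.fst.comp .snd)))))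
  diag_prim := primrec_diag _ _

end

end MForm

/-! ### Conservativity and transfer to the calculi without modalities -/

namespace BForm

/-- The inclusion of the language of BCL in that of MBCL. -/
def emb : BForm → MForm
  | var i => .var i
  | neg A => .neg (emb A)
  | and A B => .and (emb A) (emb B)
  | or A B => .or (emb A) (emb B)
  | imp A B => .imp (emb A) (emb B)

theorem emb_inst (s : ℕ → BForm) (P : PL) :
    emb (inst s P) = MForm.inst (fun i => emb (s i)) P := by
  induction P with
  | var i => rfl
  | neg P ih => simp only [inst, MForm.inst, emb, ih]
  | and P Q ih1 ih2 => simp only [inst, MForm.inst, emb, ih1, ih2]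
  | or P Q ih1 ih2 => simp only [inst, MForm.inst, emb, ih1, ih2]

theorem emb_negs (k : ℕ) (A : BForm) : emb (negs k A) = MForm.negs k (emb A) := by
  induction k with
  | zero => rfl
  | succ k ih => simp only [negs, MForm.negs, emb, ih]

end BForm

namespace MForm

/-- The formula with its modal operators erased. -/
def erase : MForm → BForm
  | var i => .var i
  | neg A => .neg (erase A)
  | and A B => .and (erase A) (erase B)
  | or A B => .or (erase A) (erase B)
  | imp A B => .imp (erase A) (erase B)
  | box A => erase A
  | dia A => erase A

theorem erase_inst (s : ℕ → MForm) (P : PL) :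
    erase (inst s P) = BForm.inst (fun i => erase (s i)) P := by
  induction P with
  | var i => rfl
  | neg P ih => simp only [inst, BForm.inst, erase, ih]
  | and P Q ih1 ih2 => simp only [inst, BForm.inst, erase, ih1, ih2]
  | or P Q ih1 ih2 => simp only [inst, BForm.inst, erase, ih1, ih2]

theorem erase_negs (k : ℕ) (A : MForm) : erase (negs k A) = BForm.negs k (erase A) := by
  induction k with
  | zero => rfl
  | succ k ih => simp only [negs, BForm.negs, erase, ih]

theorem erase_emb (A : BForm) : erase A.emb = A := by
  induction A with
  | var i => rfl
  | neg A ih => simp only [BForm.emb, erase, ih]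
  | and A B ih1 ih2 => simp only [BForm.emb, erase, ih1, ih2]
  | or A B ih1 ih2 => simp only [BForm.emb, erase, ih1, ih2]
  | imp A B ih1 ih2 => simp only [BForm.emb, erase, ih1, ih2]

theorem erase_ax {A : MForm} (h : AxMBCL A) : AxBCL (erase A) := by
  cases h with
  | cpl P s hP => rw [erase_inst]; exact .cpl P _ hP
  | a1 A => exact .a1 _
  | a2 A => exact .a2 _
  | b1 A B => exact .b1 _ _
  | b2 A B => exact .b2 _ _
  | impl A B => exact .impl _ _
  | dual A =>
    refine .cpl (.and (.or (.neg (.var 0)) (.neg (.neg (.var 0))))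
      (.or (.neg (.neg (.neg (.var 0)))) (.var 0))) (fun _ => erase A) fun v => ?_
    simp only [PL.eval]; cases v 0 <;> rfl
  -- After erasure the axiom has the form `X ⊃ X` with `X = A ⊃ B`.
  | kk A B =>
    refine .cpl (.or (.neg (.or (.neg (.var 0)) (.var 1))) (.or (.neg (.var 0)) (.var 1)))
      (fun i => if i = 0 then erase A else erase B) fun v => ?_
    simp only [PL.eval]; cases v 0 <;> cases v 1 <;> rfl

theorem erase_axGCUN {k l m n : ℕ} {A : MForm} (h : AxMBCLGCUN k l m n A) :
    AxBCLGCUN k l m n (erase A) := by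
  cases h with
  | base h => exact .base (erase_ax h)
  | cun1 A B => exact .cun1 _ _
  | cun2 A B => exact .cun2 _ _
  | gcun1 A B => simp only [mimp, erase, erase_negs]; exact .gcun1 _ _
  | gcun2 A B => simp only [mimp, erase, erase_negs]; exact .gcun2 _ _

theorem erase_thm {Ax : MForm → Prop} {Ax' : BForm → Prop} (h : ∀ A, Ax A → Ax' (erase A))
    {A : MForm} (hA : MBCLTheorem Ax A) : BCLTheorem Ax' (erase A) := by
  induction hA with
  | ax hA => exact .ax (h _ hA)
  | ds _ _ i1 i2 => exact .ds i1 i2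
  | nec _ ih => exact ih

end MForm

namespace BForm

theorem emb_ax {A : BForm} (h : AxBCL A) : AxMBCL (emb A) := by
  cases h with
  | cpl P s hP => rw [emb_inst]; exact .cpl P _ hP
  | a1 A => exact .a1 _
  | a2 A => exact .a2 _
  | b1 A B => exact .b1 _ _
  | b2 A B => exact .b2 _ _
  | impl A B => exact .impl _ _

theorem emb_axGCUN {k l m n : ℕ} {A : BForm} (h : AxBCLGCUN k l m n A) :
    AxMBCLGCUN k l m n (emb A) := by
  cases h with
  | base h => exact .base (emb_ax h)
  | cun1 A B => exact .cun1 _ _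
  | cun2 A B => exact .cun2 _ _
  | gcun1 A B => simp only [mimp, emb, emb_negs]; exact .gcun1 _ _
  | gcun2 A B => simp only [mimp, emb, emb_negs]; exact .gcun2 _ _

theorem emb_thm {Ax : MForm → Prop} {Ax' : BForm → Prop} (h : ∀ A, Ax' A → Ax (emb A))
    {A : BForm} (hA : BCLTheorem Ax' A) : MBCLTheorem Ax (emb A) := by
  induction hA with
  | ax hA => exact .ax (h _ hA)
  | ds _ _ i1 i2 => exact .ds i1 i2

theorem primrec_emb : Primrec emb := by
  have h : Primrec₂ fun (_ : Unit) (x : ℕ) => MForm.code (emb (ofCode x)) := by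
    -- Course-of-values recursion: the list `L` holds the translated codes of all smaller numbers,
    -- so its length is the current code. The constructors keep their residues `0` to `4`; only the
    -- base changes from 5 to 7. The default `0` is never used, since subformulas have smaller
    -- codes.
    refine Primrec.nat_strong_rec _ (g := fun _ L => some
      (if L.length % 5 = 0 then 7 * (L.length / 5)
        else if L.length % 5 = 1 then 7 * L.getD (L.length / 5) 0 + 1
        else 7 * Nat.pair (L.getD (Nat.unpair (L.length / 5)).1 0)
          (L.getD (Nat.unpair (L.length / 5)).2 0) + L.length % 5)) ?_ ?_
    · have hl : Primrec fun q : Unit × List ℕ => q.2.length := Primrec.list_length.comp .snd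
      have hd := Primrec.nat_div.comp hl (Primrec.const 5)
      have hm := Primrec.nat_mod.comp hl (Primrec.const 5)
      have hu := Primrec.unpair.comp hd
      have hg : ∀ {f : Unit × List ℕ → ℕ}, Primrec f →
          Primrec fun q : Unit × List ℕ => q.2.getD (f q) 0 :=
        fun hf => (Primrec.list_getD 0).comp .snd hf
      exact Primrec.option_some.comp (Primrec.ite (Primrec.eq.comp hm (.const 0))
        (Primrec.nat_mul.comp (.const 7) hd)
        (Primrec.ite (Primrec.eq.comp hm (.const 1))
          (Primrec.nat_add.comp (Primrec.nat_mul.comp (.const 7) (hg hd)) (.const 1))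
          (Primrec.nat_add.comp (Primrec.nat_mul.comp (.const 7) (Primrec₂.natPair.comp
            (hg (Primrec.fst.comp hu)) (hg (Primrec.snd.comp hu)))) hm)))
    · intro _ x
      have hget : ∀ A, code A < x → ((List.range x).map fun x => MForm.code (emb (ofCode x))).getD
          (code A) 0 = MForm.code (emb A) := fun A hA => by
        simp [List.getD, hA, ofCode_code]
      have hp1 := Nat.left_le_pair
      have hp2 := Nat.right_le_pair
      obtain ⟨A, rfl⟩ : ∃ A, x = code A := ⟨ofCode x, (code_ofCode x).symm⟩
      simp only [List.length_map, List.length_range, ofCode_code, Option.some.injEq]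
      cases A with
      | var i =>
        rw [if_pos (by simp only [code]; omega)]
        simp only [code, emb, MForm.code]; omega
      | neg A =>
        have e1 : code (neg A) % 5 = 1 := by simp only [code]; omega
        have e2 : code (neg A) / 5 = code A := by simp only [code]; omega
        rw [e1, e2, hget A (by simp only [code]; omega)]
        rfl
      | and A B =>
        have := hp1 (code A) (code B)
        have := hp2 (code A) (code B)
        have e1 : code (and A B) % 5 = 2 := by simp only [code]; omega
        have e2 : code (and A B) / 5 = Nat.pair (code A) (code B) := by simp only [code]; omega
        rw [e1, e2, Nat.unpair_pair, hget A (by simp only [code]; omega),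
          hget B (by simp only [code]; omega)]
        rfl
      | or A B =>
        have := hp1 (code A) (code B)
        have := hp2 (code A) (code B)
        have e1 : code (or A B) % 5 = 3 := by simp only [code]; omega
        have e2 : code (or A B) / 5 = Nat.pair (code A) (code B) := by simp only [code]; omega
        rw [e1, e2, Nat.unpair_pair, hget A (by simp only [code]; omega),
          hget B (by simp only [code]; omega)]
        rfl
      | imp A B =>
        have := hp1 (code A) (code B)
        have := hp2 (code A) (code B)
        have e1 : code (imp A B) % 5 = 4 := by simp only [code]; omega
        have e2 : code (imp A B) / 5 = Nat.pair (code A) (code B) := by simp only [code]; omega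
        rw [e1, e2, Nat.unpair_pair, hget A (by simp only [code]; omega),
          hget B (by simp only [code]; omega)]
        rfl
  refine MForm.primrec_of_code ((h.comp (.const ()) (Primrec.of_equiv (e := codeEquiv))).of_eq
    fun A => ?_)
  exact congrArg (fun A => MForm.code (emb A)) (ofCode_code A)

theorem computable_of_modal {Ax : MForm → Prop} {Ax' : BForm → Prop}
    (h : ∀ A, Ax' A → Ax (emb A)) (h' : ∀ A, Ax A → Ax' A.erase)
    (hAx : ComputablePred (MBCLTheorem Ax)) : ComputablePred (BCLTheorem Ax') := by
  refine hAx.computable_of_manyOneReducible ⟨emb, primrec_emb.to_comp, fun A =>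
    ⟨emb_thm h, fun hA => ?_⟩⟩
  have := MForm.erase_thm h' hA
  rwa [MForm.erase_emb] at this

end BForm

end Connexive

theorem mainTheorem6 :
    ComputablePred (Connexive.BCLTheorem Connexive.AxBCL) ∧
    ComputablePred (Connexive.MBCLTheorem Connexive.AxMBCL) ∧
    ∀ k l m n : ℕ, k ≤ m → l ≤ n → Even k → Even l →
      ComputablePred (Connexive.BCLTheorem (Connexive.AxBCLGCUN k l m n)) ∧
      ComputablePred (Connexive.MBCLTheorem (Connexive.AxMBCLGCUN k l m n)) := by
  have h : ComputablePred (Connexive.MBCLTheorem Connexive.AxMBCL) :=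
    Connexive.MForm.basicSys.computable
  refine ⟨Connexive.BForm.computable_of_modal (fun _ => Connexive.BForm.emb_ax)
    (fun _ => Connexive.MForm.erase_ax) h, h, fun k l m n hkm hln _ _ => ?_⟩
  have h' : ComputablePred (Connexive.MBCLTheorem (Connexive.AxMBCLGCUN k l m n)) :=
    (Connexive.MForm.gcunSys hkm hln).computable
  exact ⟨Connexive.BForm.computable_of_modal (fun _ => Connexive.BForm.emb_axGCUN)
    (fun _ => Connexive.MForm.erase_axGCUN) h', h'⟩
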